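/- **Conventions.** Let $G_1,G_2$ be graphs. The data of a tree amalgamation of $G_1$ and $G_2$ are: a tree $T$ with bipartition $V_1,V_2$ of its vertex set; label sets $K_1,K_2$; a map $c\colon E(T)\to K_1\times K_2$ such that for $i=1,2$ and every $v\in V_i$ the $i$-th coordinate of $c$ restricts to a bijection from the set of edges at $v$ onto $K_i$ (so every vertex in $V_i$ has degree $|K_i|$); families $(S^1_k)_{k\in K_1}$ and $(S^2_\ell)_{\ell\in K_2}$ of non-empty subsets of $V(G_1)$ and $V(G_2)$, respectively, called the adhesion sets; and bijections $\varphi_{k,\ell}\colon S^1_k\to S^2_\ell$ for all $k\in K_1$, $\ell\in K_2$. Take the disjoint union of copies $G_i^v$ of $G_i$, one for each $v\in V_i$, $i=1,2$; for every edge $vu$ of $T$ with $v\in V_1$, $u\in V_2$ and $c(vu)=(k,\ell)$, join the copy of $x$ in $G_1^v$ to the copy of $\varphi_{k,\ell}(x)$ in $G_2^u$ for every $x\in S^1_k$; then contract all these new edges, deleting loops and parallel edges. The resulting graph is the tree amalgamation $G_1\ast_T G_2$; let $\psi$ denote the canonical map from the vertices of the copies onto its vertices. The amalgamation is *trivial*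 if the restriction of $\psi$ to some copy $G_i^v$ is a bijection onto $V(G_1\ast_TG_2)$. It has *finite adhesion* if all adhesion sets are finite. The *identification size* of a vertex $a$ of $G_1\ast_T G_2$ is the smallest number of vertices of a subtree $T'$ of $T$ such that $\psi^{-1}(a)$ is contained in the union of the copies at vertices of $T'$; the amalgamation has *finite identification* if the identification sizes of its vertices have a finite upper bound. A group of automorphisms of a graph acts *quasi-transitively* on the graph if it has finitely many orbits on the vertices; it acts quasi-transitively on a set of vertex sets if it leaves this set invariant and has finitely many orbits on it. A graph is quasi-transitive if its full automorphism group acts quasi-transitively on it. Graphs $G$ and $H$ are *quasi-isometric* if there are a map $f\colon V(G)\to V(H)$ and constants $\gamma\ge 1$, $c\ge 0$ such that $\gamma^{-1}d_G(x,y)-c\le d_H(f(x),f(y))\le\gamma d_G(x,y)+c$ for all $x,y\in V(G)$ and every vertex of $H$ has distance at most $c$ from $f(V(G))$. **Theorem.** Let $G_1$ and $G_2$ be infinite connected locally finite quasi-transitive graphs, and let $G$ and $H$ be two non-trivial tree amalgamations of $G_1$ and $G_2$, both of finite adhesion and finite identification. Assume that for each of the two amalgamations and for $i=1,2$ there is a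 group of automorphisms of $G_i$ that acts quasi-transitively on $G_i$ and on the set of adhesion sets of $G_i$ in that amalgamation. Then $G$ is quasi-isometric to $H$. -/

import Mathlib

universe u v w w'

/-- Every vertex has only finitely many neighbours. -/
def IsLocallyFinite {V : Type u} (G : SimpleGraph V) : Prop :=
  ∀ x : V, (G.neighborSet x).Finite

/-- The group `Γ` of automorphisms of `G` has only finitely many orbits on the vertices. -/
def ActsQuasiTransitively {V : Type u} {G : SimpleGraph V} (Γ : Subgroup (G ≃g G)) : Prop :=
  ∃ F : Set V, F.Finite ∧ ∀ x : V, ∃ γ ∈ Γ, ∃ y ∈ F, γ y = x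

/-- The group `Γ` of automorphisms of `G` acts on the set `𝒮` of vertex sets (that is, `𝒮` is
`Γ`-invariant), and this action has only finitely many orbits. -/
def ActsQuasiTransitivelyOnSets {V : Type u} {G : SimpleGraph V} (Γ : Subgroup (G ≃g G))
    (𝒮 : Set (Set V)) : Prop :=
  (∀ γ ∈ Γ, ∀ s ∈ 𝒮, (fun x => γ x) '' s ∈ 𝒮) ∧
    ∃ F : Set (Set V), F ⊆ 𝒮 ∧ F.Finite ∧ ∀ s ∈ 𝒮, ∃ γ ∈ Γ, ∃ t ∈ F, (fun x => γ x) '' t = s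

/-- The full automorphism group of `G` has only finitely many orbits on the vertices. -/
def IsQuasiTransitive {V : Type u} (G : SimpleGraph V) : Prop :=
  ActsQuasiTransitively (⊤ : Subgroup (G ≃g G))

/-- `f` is a `(γ, c)`-quasi-isometry. The distance of two vertices in different components counts
as infinite; since `SimpleGraph.dist` is `0` there, reachability is treated separately. -/
structure IsQuasiIsometryWith {V : Type u} {W : Type v} (G : SimpleGraph V) (H : SimpleGraph W)
    (γ c : ℝ) (f : V → W) : Prop where
  reachable_iff : ∀ x y : V, G.Reachable x y ↔ H.Reachable (f x) (f y)
  lower : ∀ x y : V, G.Reachable x y →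
    γ⁻¹ * (G.dist x y : ℝ) - c ≤ (H.dist (f x) (f y) : ℝ)
  upper : ∀ x y : V, G.Reachable x y →
    (H.dist (f x) (f y) : ℝ) ≤ γ * (G.dist x y : ℝ) + c
  dense : ∀ z : W, ∃ x : V, H.Reachable z (f x) ∧ (H.dist z (f x) : ℝ) ≤ c

/-- `G` is quasi-isometric to `H`. -/
def QuasiIsometric {V : Type u} {W : Type v} (G : SimpleGraph V) (H : SimpleGraph W) : Prop :=
  ∃ (γ c : ℝ) (f : V → W), 1 ≤ γ ∧ 0 ≤ c ∧ IsQuasiIsometryWith G H γ c f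

/-- The data of a tree amalgamation of `G₁` and `G₂`: a semiregular tree `T` with bipartition
`N₁`, `N₂`, an edge labelling, families of adhesion sets in `G₁` and `G₂` indexed by the possible
labels `K₁`, `K₂`, and bijections between adhesion sets. -/
structure TreeAmalgamation {V₁ : Type u} {V₂ : Type v} (G₁ : SimpleGraph V₁)
    (G₂ : SimpleGraph V₂) where
  /-- The nodes of the tree that are replaced by copies of `G₁`. -/
  N₁ : Type w
  /-- The nodes of the tree that are replaced by copies of `G₂`. -/
  N₂ : Type w
  /-- The labels on the side of `G₁`; its cardinality is the degree of the nodes in `N₁`. -/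
  K₁ : Type w
  /-- The labels on the side of `G₂`; its cardinality is the degree of the nodes in `N₂`. -/
  K₂ : Type w
  /-- The tree. -/
  T : SimpleGraph (N₁ ⊕ N₂)
  isTree : T.IsTree
  bipartite : T ≤ completeBipartiteGraph N₁ N₂
  /-- The labelling of the edges; the values at non-adjacent pairs are never used. -/
  label : N₁ → N₂ → K₁ × K₂
  /-- At each node of `N₁`, every label in `K₁` occurs on exactly one incident edge. -/
  label_fst : ∀ (s : N₁) (k : K₁), ∃! t : N₂, T.Adj (Sum.inl s) (Sum.inr t) ∧ (label s t).1 = k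
  /-- At each node of `N₂`, every label in `K₂` occurs on exactly one incident edge. -/
  label_snd : ∀ (t : N₂) (l : K₂), ∃! s : N₁, T.Adj (Sum.inl s) (Sum.inr t) ∧ (label s t).2 = l
  /-- The adhesion sets of `G₁`. -/
  S₁ : K₁ → Set V₁
  /-- The adhesion sets of `G₂`. -/
  S₂ : K₂ → Set V₂
  S₁_nonempty : ∀ k, (S₁ k).Nonempty
  S₂_nonempty : ∀ l, (S₂ l).Nonempty
  /-- The bijections along which copies are glued; in particular all adhesion sets have the same
  cardinality. -/
  φ : ∀ (k : K₁) (l : K₂), S₁ k ≃ S₂ l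

namespace TreeAmalgamation

variable {V₁ : Type u} {V₂ : Type v} {G₁ : SimpleGraph V₁} {G₂ : SimpleGraph V₂}

/-- The vertices of the disjoint union of one copy of `Gᵢ` for each node in `Nᵢ`, `i = 1, 2`. -/
abbrev CopyVertex (A : TreeAmalgamation.{u, v, w} G₁ G₂) : Type (max u v w) :=
  (A.N₁ × V₁) ⊕ (A.N₂ × V₂)

/-- The node in whose copy a vertex lies. -/
def node (A : TreeAmalgamation.{u, v, w} G₁ G₂) : A.CopyVertex → A.N₁ ⊕ A.N₂ :=
  Sum.map Prod.fst Prod.fst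

/-- The edges inside the copies of `G₁` and `G₂`. -/
inductive CopyAdj (A : TreeAmalgamation.{u, v, w} G₁ G₂) : A.CopyVertex → A.CopyVertex → Prop
  | left (s : A.N₁) {x y : V₁} (h : G₁.Adj x y) : CopyAdj A (Sum.inl (s, x)) (Sum.inl (s, y))
  | right (t : A.N₂) {x y : V₂} (h : G₂.Adj x y) : CopyAdj A (Sum.inr (t, x)) (Sum.inr (t, y))

/-- The new edges that are added to the disjoint union of the copies: for an edge `st` of the tree
with label `(k, l)`, the copy of `x ∈ S₁ k` at `s` is joined to the copy of `φ k l x` at `t`. -/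
inductive Link (A : TreeAmalgamation.{u, v, w} G₁ G₂) : A.CopyVertex → A.CopyVertex → Prop
  | mk (s : A.N₁) (t : A.N₂) (h : A.T.Adj (Sum.inl s) (Sum.inr t))
      (x : A.S₁ (A.label s t).1) :
      Link A (Sum.inl (s, (x : V₁)))
        (Sum.inr (t, (A.φ (A.label s t).1 (A.label s t).2 x : V₂)))

/-- The vertices of the tree amalgamation: all new edges are contracted. -/
def Vertex (A : TreeAmalgamation.{u, v, w} G₁ G₂) : Type (max u v w) :=
  Quot A.Link

/-- The canonical map onto the vertex set of the tree amalgamation. -/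
def ψ (A : TreeAmalgamation.{u, v, w} G₁ G₂) (p : A.CopyVertex) : A.Vertex :=
  Quot.mk A.Link p

/-- The tree amalgamation `G₁ ∗_T G₂`. -/
def graph (A : TreeAmalgamation.{u, v, w} G₁ G₂) : SimpleGraph A.Vertex where
  Adj a b := a ≠ b ∧ ∃ p q : A.CopyVertex, A.CopyAdj p q ∧ A.ψ p = a ∧ A.ψ q = b
  symm := ⟨by
    rintro a b ⟨hne, p, q, hpq, rfl, rfl⟩
    refine ⟨hne.symm, q, p, ?_, rfl, rfl⟩
    cases hpq with
    | left s h => exact CopyAdj.left s h.symm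
    | right t h => exact CopyAdj.right t h.symm⟩
  loopless := ⟨fun _ h => h.1 rfl⟩

/-- All adhesion sets are finite. -/
def FiniteAdhesion (A : TreeAmalgamation.{u, v, w} G₁ G₂) : Prop :=
  (∀ k, (A.S₁ k).Finite) ∧ ∀ l, (A.S₂ l).Finite

/-- Some copy of `G₁` or `G₂` is mapped bijectively onto the vertices of the amalgamation. -/
def IsTrivial (A : TreeAmalgamation.{u, v, w} G₁ G₂) : Prop :=
  (∃ s : A.N₁, Function.Bijective fun x : V₁ => A.ψ (Sum.inl (s, x))) ∨
    ∃ t : A.N₂, Function.Bijective fun x : V₂ => A.ψ (Sum.inr (t, x))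

/-- The smallest number of nodes of a subtree of `T` such that `a` arises by contracting only
edges between vertices in copies at nodes of that subtree. -/
noncomputable def identificationSize (A : TreeAmalgamation.{u, v, w} G₁ G₂) (a : A.Vertex) : ℕ∞ :=
  sInf {n : ℕ∞ | ∃ U : Set (A.N₁ ⊕ A.N₂), (A.T.induce U).Connected ∧
    (∀ p : A.CopyVertex, A.ψ p = a → A.node p ∈ U) ∧ U.encard = n}

/-- The identification sizes of the vertices have a finite upper bound. -/
def FiniteIdentification (A : TreeAmalgamation.{u, v, w} G₁ G₂) : Prop :=
  ∃ n : ℕ, ∀ a : A.Vertex, A.identificationSize a ≤ n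

/-- For `i = 1, 2`, some group of automorphisms of `Gᵢ` acts quasi-transitively both on `Gᵢ` and
on the set of adhesion sets of `Gᵢ`. -/
def HasQuasiTransitiveActions (A : TreeAmalgamation.{u, v, w} G₁ G₂) : Prop :=
  (∃ Γ : Subgroup (G₁ ≃g G₁),
      ActsQuasiTransitively Γ ∧ ActsQuasiTransitivelyOnSets Γ (Set.range A.S₁)) ∧
    ∃ Γ : Subgroup (G₂ ≃g G₂),
      ActsQuasiTransitively Γ ∧ ActsQuasiTransitivelyOnSets Γ (Set.range A.S₂)

end TreeAmalgamation

open SimpleGraph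

/-! Each amalgamation is replaced by a more flexible object. Adhesion sets have uniformly bounded
diameter, since each is finite and they fall into finitely many orbits. The fibres of `ψ` have
bounded diameter in the graph of new edges, by finite identification. So up to coarse equivalence
the contractions along a tree edge may be replaced by a single edge between base points. With the
tree rooted, this is a hanging: each copy except the root is attached by one edge to a vertex of its
parent copy (`coarselyEquivalent_treeHanging`).

In a hanging, the number of children at a vertex is bounded, but every vertex has arbitrarily many
children within bounded distance, because infinitely many adhesion sets are spread over each factor
by the group. A Schröder-Bernstein argument then moves some subtrees by a bounded amount so that
exactly `M` children hang at every vertex, for any `M` above the bound (`exists_exactMultiplicity`).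
Moved copies go up three generations, which respects the bipartition.

Once two hangings have the same `M` and roots of the same type, their trees can be matched
recursively from the roots. The factor isomorphisms match attaching vertices in parents exactly and
marked vertices of children up to a bounded error, by quasi-transitivity. This gives the coarse
equivalence (`coarselyEquivalent_of_exactMultiplicity`). -/

/-- The distance of `x` and `y` in `G` is at most `n`. -/
def Near {V : Type*} (G : SimpleGraph V) (n : ℕ) (x y : V) : Prop :=
  G.edist x y ≤ n

/-! ### Distance bounds and coarsely Lipschitz maps. -/

namespace Near

variable {V W : Type*} {G : SimpleGraph V} {H : SimpleGraph W} {m n : ℕ} {x y z : V}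

lemma refl (G : SimpleGraph V) (n : ℕ) (x : V) : Near G n x x := by simp [Near]

lemma symm (h : Near G n x y) : Near G n y x := by rwa [Near, edist_comm]

lemma trans (h : Near G m x y) (h' : Near G n y z) : Near G (m + n) x z := by
  unfold Near at *
  push_cast
  exact G.edist_triangle.trans (add_le_add h h')

lemma mono (hmn : m ≤ n) (h : Near G m x y) : Near G n x y :=
  le_trans h (by exact_mod_cast hmn)

lemma of_adj (h : G.Adj x y) : Near G 1 x y := by
  unfold Near
  exact_mod_cast (edist_le_one_iff_adj_or_eq.2 (Or.inl h))

lemma iff_walk : Near G n x y ↔ ∃ p : G.Walk x y, p.length ≤ n := by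
  constructor
  · intro h
    obtain ⟨p, hp⟩ := G.exists_walk_of_edist_ne_top (ne_top_of_le_ne_top (by simp) h)
    refine ⟨p, ?_⟩
    unfold Near at h
    rw [← hp] at h
    exact_mod_cast h
  · rintro ⟨p, hp⟩
    exact (G.edist_le p).trans (by exact_mod_cast hp)

lemma exists_of_reachable (h : G.Reachable x y) : ∃ n, Near G n x y := by
  obtain ⟨p⟩ := h
  exact ⟨p.length, iff_walk.2 ⟨p, le_rfl⟩⟩

lemma reachable (h : Near G n x y) : G.Reachable x y := by
  obtain ⟨p, -⟩ := iff_walk.1 h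
  exact ⟨p⟩

lemma dist_le (h : Near G n x y) : (G.dist x y : ℝ) ≤ n := by
  obtain ⟨p, hp⟩ := iff_walk.1 h
  exact_mod_cast (G.dist_le p).trans hp

/-- The predicate `P` confines the Lipschitz condition to a union of components; it is needed for
maps that are controlled on one member of a family only. -/
lemma map_of_walk {f : V → W} {C : ℕ} {P : V → Prop} (hP : ∀ a b, P a → G.Adj a b → P b)
    (hf : ∀ a b, P a → G.Adj a b → Near H C (f a) (f b)) {x y : V} (hx : P x) (p : G.Walk x y) :
    Near H (C * p.length) (f x) (f y) := by
  induction p with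
  | nil => exact refl ..
  | cons h p ih =>
    have := (hf _ _ hx h).trans (ih (hP _ _ hx h))
    refine this.mono ?_
    rw [Walk.length_cons]
    ring_nf
    exact le_rfl

lemma map_of {f : V → W} {C : ℕ} {P : V → Prop} (hP : ∀ a b, P a → G.Adj a b → P b)
    (hf : ∀ a b, P a → G.Adj a b → Near H C (f a) (f b)) {x y : V} (hx : P x)
    (h : Near G n x y) : Near H (C * n) (f x) (f y) := by
  obtain ⟨p, hp⟩ := iff_walk.1 h
  exact (map_of_walk hP hf hx p).mono (Nat.mul_le_mul_left _ hp)

lemma map {f : V → W} {C : ℕ} (hf : ∀ a b, G.Adj a b → Near H C (f a) (f b)) {x y : V}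
    (h : Near G n x y) : Near H (C * n) (f x) (f y) :=
  h.map_of (P := fun _ => True) (fun _ _ _ _ => trivial) (fun a b _ => hf a b) trivial

lemma map_adj {f : V → W} (hf : ∀ a b, G.Adj a b → H.Adj (f a) (f b)) {x y : V}
    (h : Near G n x y) : Near H n (f x) (f y) := by
  simpa using h.map (C := 1) fun a b hab => of_adj (hf a b hab)

lemma of_le {G' : SimpleGraph V} (hle : G ≤ G') (h : Near G n x y) : Near G' n x y :=
  h.map_adj (f := id) fun _ _ hab => hle hab

end Near

/-! ### Coarse equivalence. -/

/-- There are coarsely Lipschitz maps between the vertex sets that are coarsely inverse to each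
other. -/
def CoarselyEquivalent {V W : Type*} (G : SimpleGraph V) (H : SimpleGraph W) : Prop :=
  ∃ (f : V → W) (g : W → V) (C : ℕ), (∀ x y, G.Adj x y → Near H C (f x) (f y)) ∧
    (∀ x y, H.Adj x y → Near G C (g x) (g y)) ∧ (∀ x, Near G C (g (f x)) x) ∧
    ∀ y, Near H C (f (g y)) y

namespace CoarselyEquivalent

variable {U V W : Type*} {K : SimpleGraph U} {G : SimpleGraph V} {H : SimpleGraph W}

lemma symm (h : CoarselyEquivalent G H) : CoarselyEquivalent H G := by
  obtain ⟨f, g, C, h1, h2, h3, h4⟩ := h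
  exact ⟨g, f, C, h2, h1, h4, h3⟩

lemma trans (h : CoarselyEquivalent K G) (h' : CoarselyEquivalent G H) :
    CoarselyEquivalent K H := by
  obtain ⟨f, g, C, h1, h2, h3, h4⟩ := h
  obtain ⟨f', g', C', h1', h2', h3', h4'⟩ := h'
  refine ⟨f' ∘ f, g ∘ g', C * C' + C + C', ?_, ?_, ?_, ?_⟩
  · intro x y hxy
    exact ((h1 x y hxy).map h1').mono (by nlinarith)
  · intro x y hxy
    exact ((h2' x y hxy).map h2).mono (by nlinarith)
  · intro x
    exact (((h3' (f x)).map h2).trans (h3 x)).mono (by nlinarith)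
  · intro y
    exact (((h4 (g' y)).map h1').trans (h4' y)).mono (by nlinarith)

lemma quasiIsometric (h : CoarselyEquivalent G H) : QuasiIsometric G H := by
  obtain ⟨f, g, C, h1, h2, h3, h4⟩ := h
  have lip : ∀ {x y}, G.Reachable x y → Near H (C * G.dist x y) (f x) (f y) := by
    intro x y hxy
    obtain ⟨p, hp⟩ := hxy.exists_walk_length_eq_dist
    exact (Near.iff_walk.2 ⟨p, hp.le⟩).map h1
  have lip' : ∀ {x y}, H.Reachable (f x) (f y) →
      Near G (C + C * H.dist (f x) (f y) + C) x y := by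
    intro x y hxy
    obtain ⟨p, hp⟩ := hxy.exists_walk_length_eq_dist
    exact ((h3 x).symm.trans ((Near.iff_walk.2 ⟨p, hp.le⟩).map h2)).trans (h3 y)
  refine ⟨C + 1, 2 * (C + 1), f, by simp, by positivity, ?_, ?_, ?_, ?_⟩
  · exact fun x y => ⟨fun h => (lip h).reachable, fun h => (lip' h).reachable⟩
  · intro x y hxy
    have := Near.dist_le (lip' (lip hxy).reachable)
    push_cast at this
    rw [sub_le_iff_le_add, inv_mul_le_iff₀ (by positivity)]
    have h0 : (0 : ℝ) ≤ H.dist (f x) (f y) := by positivity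
    have h1 : (0 : ℝ) ≤ C := by positivity
    nlinarith
  · intro x y hxy
    have := Near.dist_le (lip hxy)
    push_cast at this
    have h0 : (0 : ℝ) ≤ G.dist x y := by positivity
    have h1 : (0 : ℝ) ≤ C := by positivity
    nlinarith
  · intro z
    refine ⟨g z, (h4 z).symm.reachable, ?_⟩
    have := Near.dist_le (h4 z).symm
    have h1 : (0 : ℝ) ≤ C := by positivity
    linarith

end CoarselyEquivalent

/-! ### Families of graphs hung along a rooted tree. -/

/-- A family of disjoint graphs indexed by `N`, given by their union `E`, together with a marked
vertex in each of them, a type and a level for each index, and a distinguished index. -/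
structure SpaceFamily (N V : Type*) where
  E : SimpleGraph V
  node : V → N
  node_eq_of_adj : ∀ x y, E.Adj x y → node x = node y
  root : N
  att : N → V
  node_att : ∀ n, node (att n) = n
  lev : N → ℕ
  ty : N → Bool

namespace SpaceFamily

variable {N V N' V' : Type*}

lemma node_eq_of_near (S : SpaceFamily N V) {R : ℕ} {x y : V} (h : Near S.E R x y) :
    S.node x = S.node y := by
  obtain ⟨p, -⟩ := Near.iff_walk.1 h
  clear h
  induction p with
  | nil => rfl
  | cons h _ ih => exact (S.node_eq_of_adj _ _ h).trans ih

/-- A way of hanging each member of the family, except for the distinguished one, at a vertex of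
another member of lower level and of the other type. -/
structure Hanging (S : SpaceFamily N V) where
  par : N → V
  lev_par : ∀ n, n ≠ S.root → S.lev (S.node (par n)) < S.lev n
  ty_par : ∀ n, n ≠ S.root → S.ty n = !S.ty (S.node (par n))

namespace Hanging

variable {S : SpaceFamily N V} {S' : SpaceFamily N' V'}

/-- The graph obtained by joining the marked vertex of each member of the family to the vertex at
which this member hangs. -/
def graph (D : S.Hanging) : SimpleGraph V where
  Adj x y := S.E.Adj x y ∨ ∃ n, n ≠ S.root ∧
    (x = S.att n ∧ y = D.par n ∨ y = S.att n ∧ x = D.par n)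
  symm := ⟨by
    rintro x y (h | ⟨n, hn, h⟩)
    · exact Or.inl h.symm
    · exact Or.inr ⟨n, hn, h.symm⟩⟩
  loopless := ⟨by
    have key : ∀ n, n ≠ S.root → S.att n ≠ D.par n := by
      intro n hn h
      have := D.lev_par n hn
      rw [← h, S.node_att] at this
      exact lt_irrefl _ this
    rintro x (h | ⟨n, hn, ⟨h, h'⟩ | ⟨h, h'⟩⟩)
    · exact S.E.loopless.irrefl _ h
    · exact key n hn (h.symm.trans h')
    · exact key n hn (h.symm.trans h')⟩

lemma le_graph (D : S.Hanging) : S.E ≤ D.graph := fun _ _ h => Or.inl h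

lemma adj_par (D : S.Hanging) {n : N} (hn : n ≠ S.root) : D.graph.Adj (S.att n) (D.par n) :=
  Or.inr ⟨n, hn, Or.inl ⟨rfl, rfl⟩⟩

lemma near_par (D : S.Hanging) {n : N} (hn : n ≠ S.root) :
    Near D.graph 1 (S.att n) (D.par n) := Near.of_adj (D.adj_par hn)

lemma near_map_of_adj (D : S.Hanging) {H : SimpleGraph V'} {f : V → V'} {C : ℕ}
    (hE : ∀ x y, S.E.Adj x y → Near H C (f x) (f y))
    (hpar : ∀ n, n ≠ S.root → Near H C (f (S.att n)) (f (D.par n))) (x y : V)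
    (hxy : D.graph.Adj x y) : Near H C (f x) (f y) := by
  rcases hxy with h | ⟨n, hn, ⟨rfl, rfl⟩ | ⟨rfl, rfl⟩⟩
  · exact hE x y h
  · exact hpar n hn
  · exact (hpar n hn).symm

/-- At most `M` members hang at each vertex. -/
def MultiplicityLE (D : S.Hanging) (M : ℕ) : Prop :=
  ∀ v : V, {n | n ≠ S.root ∧ D.par n = v}.encard ≤ M

/-- For each `m` there is `R` such that near each vertex at least `m` members hang. -/
def Abundant (D : S.Hanging) : Prop :=
  ∀ m : ℕ, ∃ R : ℕ, ∀ v : V, ∃ t : Finset N, t.card = m ∧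
    ∀ n ∈ t, n ≠ S.root ∧ Near S.E R v (D.par n)

/-- Exactly `M` members hang at each vertex. -/
def ExactMultiplicity (D : S.Hanging) (M : ℕ) : Prop :=
  ∃ idx : N → Fin M, ∀ (v : V) (j : Fin M), ∃! n, n ≠ S.root ∧ D.par n = v ∧ idx n = j

end Hanging

/-- Balls in the members of the family are finite, uniformly for each radius. -/
def BoundedBalls (S : SpaceFamily N V) : Prop :=
  ∀ R : ℕ, ∃ m : ℕ, ∀ v : V, {x | Near S.E R x v}.encard ≤ m

end SpaceFamily

/-! ### Rehanging to obtain exact multiplicity. -/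

lemma Set.exists_injOn_lt_of_encard_le {α : Type*} {s : Set α} {m : ℕ} (h : s.encard ≤ m) :
    ∃ g : α → ℕ, Set.InjOn g s ∧ ∀ x ∈ s, g x < m := by
  classical
  have hs : s.Finite := Set.finite_of_encard_le_coe h
  have hcard : s.ncard ≤ m := by
    rw [← hs.cast_ncard_eq] at h
    exact_mod_cast h
  have := hs.fintype
  obtain ⟨e⟩ : Nonempty (s ≃ Fin s.ncard) := by
    refine ⟨Fintype.equivFinOfCardEq ?_⟩
    rw [Set.ncard_eq_toFinset_card', Set.toFinset_card]
  refine ⟨fun x => if hx : x ∈ s then e ⟨x, hx⟩ else 0, ?_, ?_⟩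
  · intro x hx y hy hxy
    simp only [hx, hy, dif_pos] at hxy
    simpa using e.injective (Fin.ext hxy)
  · intro x hx
    simp only [hx, dif_pos]
    exact (e ⟨x, hx⟩).2.trans_le hcard

namespace SpaceFamily.Hanging

variable {N V : Type*} {S : SpaceFamily N V}

/-- In a given hanging, the members that may be rehung, one child `σ n` for each `n`, together
with the vertices `v` at which they may be rehung. -/
lemma exists_moves (D : S.Hanging) (M : ℕ) (habd : D.Abundant) (hball : S.BoundedBalls) :
    ∃ (R : ℕ) (σ : N → N) (r : V → N) (c : V × Fin M → N),
      (∀ n, σ n ≠ S.root ∧ Near S.E R (S.att n) (D.par (σ n))) ∧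
      (∀ v, r v ≠ S.root ∧ Near S.E R v (D.par (r v)) ∧ ∀ n, r v ≠ σ n) ∧
      (∀ p, c p ≠ S.root ∧ Near S.E R (S.att (r p.1)) (D.par (c p)) ∧ ∀ n, c p ≠ σ n) ∧
      Function.Injective c := by
  classical
  obtain ⟨R₁, h₁⟩ := habd 1
  obtain ⟨R₂, h₂⟩ := habd 2
  have hσ : ∀ n, ∃ k, k ≠ S.root ∧ Near S.E R₁ (S.att n) (D.par k) := by
    intro n
    obtain ⟨t, ht, h⟩ := h₁ (S.att n)
    obtain ⟨k, hk⟩ := Finset.card_pos.1 (ht ▸ Nat.one_pos)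
    exact ⟨k, h k hk⟩
  choose σ hσr hσn using hσ
  have hσnode : ∀ n, S.node (D.par (σ n)) = n := fun n => by
    rw [← S.node_eq_of_near (hσn n), S.node_att]
  have hr : ∀ v, ∃ k, k ≠ S.root ∧ Near S.E R₂ v (D.par k) ∧ ∀ n, k ≠ σ n := by
    intro v
    obtain ⟨t, ht, h⟩ := h₂ v
    -- Since `σ n` hangs in `n`, the only child of `S.node v` of the form `σ n` is the one with `n =
    -- S.node v`. Two nearby children therefore suffice.
    have : 0 < (t.erase (σ (S.node v))).card := by
      have := Finset.pred_card_le_card_erase (s := t) (a := σ (S.node v))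
      omega
    obtain ⟨k, hk⟩ := Finset.card_pos.1 this
    rw [Finset.mem_erase] at hk
    refine ⟨k, (h k hk.2).1, (h k hk.2).2, ?_⟩
    rintro n rfl
    have := S.node_eq_of_near (h _ hk.2).2
    rw [hσnode] at this
    exact hk.1 (by rw [this])
  choose r hrr hrn hrσ using hr
  obtain ⟨Δ, hΔ⟩ := hball R₂
  -- At most `Δ` vertices `v` share the same `k = r v`, as all lie within `R₂` of `D.par k`. Each
  -- needs `M` children of `k`, and one more child is allowed for discarding `σ k`.
  obtain ⟨R₃, h₃⟩ := habd (Δ * M + 1)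
  have hidx : ∀ k, ∃ g : V → ℕ, Set.InjOn g {v | r v = k} ∧ ∀ v ∈ {v | r v = k}, g v < Δ := by
    intro k
    refine Set.exists_injOn_lt_of_encard_le ((Set.encard_le_encard ?_).trans (hΔ (D.par k)))
    rintro v rfl
    exact hrn v
  choose g hg hgΔ using hidx
  have he : ∀ k, ∃ e : Fin (Δ * M) → N, Function.Injective e ∧ ∀ i, e i ≠ S.root ∧
      Near S.E R₃ (S.att k) (D.par (e i)) ∧ ∀ n, e i ≠ σ n := by
    intro k
    obtain ⟨t, ht, h⟩ := h₃ (S.att k)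
    have hcard : Δ * M ≤ (t.erase (σ k)).card := by
      have := Finset.pred_card_le_card_erase (s := t) (a := σ k)
      omega
    obtain ⟨t', ht', hcard'⟩ := Finset.exists_subset_card_eq hcard
    refine ⟨fun i => (t'.equivFinOfCardEq hcard').symm i, ?_, ?_⟩
    · exact Subtype.val_injective.comp (Equiv.injective _)
    · intro i
      have hi := ht' ((t'.equivFinOfCardEq hcard').symm i).2
      rw [Finset.mem_erase] at hi
      refine ⟨(h _ hi.2).1, (h _ hi.2).2, ?_⟩
      intro n hn
      dsimp only at hn
      have := S.node_eq_of_near (h _ hi.2).2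
      rw [hn, hσnode, S.node_att] at this
      exact hi.1 (by rw [hn, this])
  choose e heinj her hen heσ using he
  -- The code of `(v, j)` among all pairs with the same `r v`: `g` separates the vertices.
  let i : V × Fin M → Fin (Δ * M) := fun p =>
    finProdFinEquiv (⟨g (r p.1) p.1, hgΔ (r p.1) p.1 rfl⟩, p.2)
  refine ⟨R₁ + R₂ + R₃, σ, r, fun p => e (r p.1) (i p), fun n => ⟨hσr n, (hσn n).mono (by omega)⟩,
    fun v => ⟨hrr v, (hrn v).mono (by omega), hrσ v⟩,
    fun p => ⟨her _ _, (hen _ _).mono (by omega), heσ _ _⟩, ?_⟩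
  rintro ⟨v, j⟩ ⟨v', j'⟩ h
  dsimp only at h
  have hn := S.node_eq_of_near (hen (r v) (i (v, j)))
  have hn' := S.node_eq_of_near (hen (r v') (i (v', j')))
  rw [h, ← hn', S.node_att, S.node_att] at hn
  rw [hn] at h
  have hi := finProdFinEquiv.injective (heinj _ h)
  simp only [Prod.mk.injEq, Fin.mk.injEq] at hi
  obtain ⟨h1, rfl⟩ := hi
  rw [hn] at h1
  rw [hg (r v') hn rfl h1]

/-- The bound `M` injects the nonroot members into `V × Fin M`, and `p ↦ σ (c p)` injects back. A
bijection built from the two tells where each member is to hang. The only members that move are of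
the form `σ (c p)`, while the members `r v` and `c p` on the way to them stay put, so both the old
and the new attaching edge can be bypassed by a bounded detour. -/
theorem exists_exactMultiplicity (D : S.Hanging) {M : ℕ} (hM : D.MultiplicityLE M)
    (habd : D.Abundant) (hball : S.BoundedBalls) :
    ∃ D' : S.Hanging, D'.ExactMultiplicity M ∧ CoarselyEquivalent D.graph D'.graph := by
  classical
  obtain ⟨R, σ, r, c, hσ, hr, hc, hcinj⟩ := D.exists_moves M habd hball
  have hσnode : ∀ n, S.node (D.par (σ n)) = n := fun n => by
    rw [← S.node_eq_of_near (hσ n).2, S.node_att]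
  have hrnode : ∀ v, S.node (D.par (r v)) = S.node v := fun v =>
    (S.node_eq_of_near (hr v).2.1).symm
  have hcnode : ∀ p, S.node (D.par (c p)) = r p.1 := fun p => by
    rw [← S.node_eq_of_near (hc p).2.1, S.node_att]
  let f : V × Fin M → {n // n ≠ S.root} := fun p => ⟨σ (c p), (hσ _).1⟩
  have hf : Function.Injective f := by
    intro p q h
    have h1 : σ (c p) = σ (c q) := congrArg Subtype.val h
    apply hcinj
    rw [← hσnode (c p), h1, hσnode]
  choose g hg hgM using fun v => Set.exists_injOn_lt_of_encard_le (hM v)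
  let k : {n // n ≠ S.root} → V × Fin M := fun n =>
    (D.par n, ⟨g (D.par n) n, hgM (D.par n) n ⟨n.2, rfl⟩⟩)
  have hk : Function.Injective k := by
    intro n n' h
    simp only [k, Prod.mk.injEq, Fin.mk.injEq] at h
    obtain ⟨h1, h2⟩ := h
    rw [h1] at h2
    exact Subtype.ext (hg (D.par n') ⟨n.2, h1⟩ ⟨n'.2, rfl⟩ h2)
  -- The relational form of Schröder-Bernstein keeps track of which injection was used: each member
  -- either keeps its vertex or is some `σ (c p)` rehung at `p.1`.
  obtain ⟨h, hbij, hrel⟩ := Function.Embedding.schroeder_bernstein_of_rel hf hk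
    (fun p n => D.par n = p.1 ∨ (n : N) = σ (c p)) (fun p => Or.inr rfl) (fun n => Or.inl rfl)
  let b := Equiv.ofBijective h hbij
  have hbrel : ∀ n : {n // n ≠ S.root},
      D.par n = (b.symm n).1 ∨ (n : N) = σ (c (b.symm n)) := by
    intro n
    have := hrel (b.symm n)
    rwa [show h (b.symm n) = n from b.apply_symm_apply n] at this
  -- The value at the root is arbitrary.
  let par' : N → V := fun n => if hn : n ≠ S.root then (b.symm ⟨n, hn⟩).1 else S.att n
  have hpar' : ∀ n, n ≠ S.root → D.par n = par' n ∨ ∃ p : V × Fin M, par' n = p.1 ∧ n = σ (c p) := by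
    intro n hn
    have := hbrel ⟨n, hn⟩
    simp only [par', dif_pos hn]
    rcases this with h | h
    · exact Or.inl h
    · exact Or.inr ⟨_, rfl, h⟩
  have hsame : ∀ n, n ≠ S.root → (∀ n', n ≠ σ n') → D.par n = par' n := by
    intro n hn h
    rcases hpar' n hn with h' | ⟨p, -, h'⟩
    · exact h'
    · exact absurd h' (h _)
  let D' : S.Hanging :=
    { par := par'
      lev_par := by
        intro n hn
        rcases hpar' n hn with h | ⟨p, h, rfl⟩
        · rw [← h]
          exact D.lev_par n hn
        -- A rehung member was a great-grandchild of its new parent, through `c p` and `r p.1`, so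
        -- its level still exceeds that of the parent.
        · have h1 := D.lev_par _ hn
          have h2 := D.lev_par _ (hc p).1
          have h3 := D.lev_par _ (hr p.1).1
          rw [hσnode] at h1
          rw [hcnode] at h2
          rw [hrnode] at h3
          rw [h]
          omega
      ty_par := by
        intro n hn
        rcases hpar' n hn with h | ⟨p, h, rfl⟩
        · rw [← h]
          exact D.ty_par n hn
        -- Three generations change the type an odd number of times.
        · have h1 := D.ty_par _ hn
          have h2 := D.ty_par _ (hc p).1
          have h3 := D.ty_par _ (hr p.1).1
          rw [hσnode] at h1
          rw [hcnode] at h2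
          rw [hrnode] at h3
          rw [h, h1, h2, h3, Bool.not_not] }
  have hD' : D'.par = par' := rfl
  -- The detour consists of three attaching edges and three walks of length at most `R` inside
  -- members.
  refine ⟨D', ?_, id, id, 3 * R + 3, ?_, ?_, fun x => Near.refl .., fun x => Near.refl ..⟩
  -- For `M = 0` there is no index to give to the root, but then no member can exist: it would have
  -- a child, which needs a place in `Fin 0`.
  · rcases Nat.eq_zero_or_pos M with rfl | hMpos
    · have : IsEmpty N := by
        refine ⟨fun n => ?_⟩
        exact (k ⟨σ n, (hσ n).1⟩).2.elim0
      exact ⟨fun n => isEmptyElim n, fun _ j => j.elim0⟩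
    refine ⟨fun n => if hn : n ≠ S.root then (b.symm ⟨n, hn⟩).2 else ⟨0, hMpos⟩, ?_⟩
    intro v j
    refine ⟨b (v, j), ⟨(b (v, j)).2, ?_, ?_⟩, ?_⟩
    · simp only [hD', par', dif_pos (b (v, j)).2, Subtype.coe_eta, Equiv.symm_apply_apply]
    · simp only [dif_pos (b (v, j)).2, Subtype.coe_eta, Equiv.symm_apply_apply]
    · rintro n ⟨hn, h1, h2⟩
      simp only [hD', par', dif_pos hn] at h1
      simp only [dif_pos hn] at h2
      have : b.symm ⟨n, hn⟩ = (v, j) := Prod.ext h1 h2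
      rw [← this, Equiv.apply_symm_apply]
  · refine D.near_map_of_adj (fun x y h => (Near.of_adj (D'.le_graph h)).mono (by omega)) ?_
    intro n hn
    simp only [id]
    rcases hpar' n hn with h | ⟨p, h, rfl⟩
    · rw [h]
      exact (D'.near_par hn).mono (by omega)
    · have e1 := D'.near_par hn
      have e2 := D'.near_par (hr p.1).1
      have e3 := D'.near_par (hc p).1
      rw [hD', h] at e1
      rw [hD', ← hsame _ (hr p.1).1 (hr p.1).2.2] at e2
      rw [hD', ← hsame _ (hc p).1 (hc p).2.2] at e3
      have d1 := (hr p.1).2.1.of_le D'.le_graph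
      have d2 := (hc p).2.1.of_le D'.le_graph
      have d3 := (hσ (c p)).2.of_le D'.le_graph
      exact (((((e1.trans d1).trans e2.symm).trans d2).trans e3.symm).trans d3).mono (by omega)
  · refine D'.near_map_of_adj (fun x y h => (Near.of_adj (D.le_graph h)).mono (by omega)) ?_
    intro n hn
    simp only [id]
    rw [hD']
    rcases hpar' n hn with h | ⟨p, h, rfl⟩
    · rw [← h]
      exact (D.near_par hn).mono (by omega)
    · have e1 := D.near_par hn
      have e2 := D.near_par (hr p.1).1
      have e3 := D.near_par (hc p).1
      have d1 := (hr p.1).2.1.of_le D.le_graph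
      have d2 := (hc p).2.1.of_le D.le_graph
      have d3 := (hσ (c p)).2.of_le D.le_graph
      rw [h]
      exact (((((e1.trans d3.symm).trans e3).trans d2.symm).trans e2).trans d1.symm).mono (by omega)

end SpaceFamily.Hanging

/-! ### Comparing two hangings of the same multiplicity. -/

namespace SpaceFamily

variable {N V N' V' : Type*}

/-- Members of the same type are isomorphic, by an isomorphism that moves the marked vertex close
to the marked vertex. -/
def SimilarMembers (S : SpaceFamily N V) (S' : SpaceFamily N' V') (R : ℕ) : Prop :=
  ∀ n n', S.ty n = S'.ty n' → ∃ (f : V → V') (g : V' → V),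
    (∀ v, S.node v = n → S'.node (f v) = n' ∧ g (f v) = v) ∧
    (∀ v, S'.node v = n' → S.node (g v) = n ∧ f (g v) = v) ∧
    (∀ v w, S.node v = n → S.E.Adj v w → S'.E.Adj (f v) (f w)) ∧
    (∀ v w, S'.node v = n' → S'.E.Adj v w → S.E.Adj (g v) (g w)) ∧
    Near S'.E R (f (S.att n)) (S'.att n')

namespace Hanging

variable {S : SpaceFamily N V} {S' : SpaceFamily N' V'}

/-- Two hangings with the same multiplicity have isomorphic trees, in a way that is compatible
with given bijections between the members. -/
lemma exists_nodeEquiv (D : S.Hanging) (D' : S'.Hanging) {M : ℕ} (hroot : S.ty S.root = S'.ty S'.root)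
    (hD : D.ExactMultiplicity M) (hD' : D'.ExactMultiplicity M)
    (f : ∀ n n', S.ty n = S'.ty n' → V → V') (g : ∀ n n', S.ty n = S'.ty n' → V' → V)
    (hf : ∀ n n' h v, S.node v = n → S'.node (f n n' h v) = n' ∧ g n n' h (f n n' h v) = v)
    (hg : ∀ n n' h v, S'.node v = n' → S.node (g n n' h v) = n ∧ f n n' h (g n n' h v) = v) :
    ∃ F : ∀ n, {n' // S.ty n = S'.ty n'}, (Function.Bijective fun n => (F n : N')) ∧
      ((F S.root : N') = S'.root) ∧ ∀ n, n ≠ S.root → (F n : N') ≠ S'.root ∧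
        D'.par (F n) = f _ _ (F (S.node (D.par n))).2 (D.par n) := by
  classical
  obtain ⟨idx, hidx⟩ := hD
  obtain ⟨idx', hidx'⟩ := hD'
  choose c hc hcu using hidx'
  have hstep : ∀ n, n ≠ S.root → ∀ n' : {n' // S.ty (S.node (D.par n)) = S'.ty n'},
      S.ty n = S'.ty (c (f _ _ n'.2 (D.par n)) (idx n)) := by
    intro n hn n'
    rw [D.ty_par n hn, D'.ty_par _ (hc _ _).1, (hc _ _).2.1, (hf _ _ n'.2 _ rfl).1]
    exact congrArg not n'.2
  -- Recursion on the level: the child with index `idx n` at a vertex goes to the child with the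
  -- same index at the image vertex. The equality of types is carried along because the map on the
  -- parent member depends on it.
  let F : ∀ n, {n' // S.ty n = S'.ty n'} :=
    (measure S.lev).wf.fix (C := fun n => {n' // S.ty n = S'.ty n'}) fun n ih =>
      if hn : n = S.root then ⟨S'.root, hn ▸ hroot⟩
      else ⟨_, hstep n hn (ih (S.node (D.par n)) (D.lev_par n hn))⟩
  have hF : ∀ n, F n = if hn : n = S.root then ⟨S'.root, hn ▸ hroot⟩
      else ⟨_, hstep n hn (F (S.node (D.par n)))⟩ := fun n => WellFounded.fix_eq _ _ n
  have hF0 : (F S.root : N') = S'.root := by rw [hF, dif_pos rfl]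
  have hF1 : ∀ n, n ≠ S.root → (F n : N') =
      c (f _ _ (F (S.node (D.par n))).2 (D.par n)) (idx n) := by
    intro n hn
    rw [hF, dif_neg hn]
  have hF2 : ∀ n, n ≠ S.root → (F n : N') ≠ S'.root := by
    intro n hn
    rw [hF1 n hn]
    exact (hc _ _).1
  refine ⟨F, ⟨?_, ?_⟩, hF0, fun n hn => ⟨hF2 n hn, ?_⟩⟩
  · intro n
    induction hl : S.lev n using Nat.strong_induction_on generalizing n with
    | _ l ih =>
    intro n₂ h
    dsimp only at h
    by_cases hn : n = S.root
    · by_contra hne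
      subst hn
      rw [hF0] at h
      exact hF2 n₂ (Ne.symm hne) h.symm
    by_cases hn₂ : n₂ = S.root
    · subst hn₂
      rw [hF0] at h
      exact absurd h (hF2 n hn)
    rw [hF1 n hn, hF1 n₂ hn₂] at h
    have hp := (hc (f _ _ (F (S.node (D.par n))).2 (D.par n)) (idx n)).2
    have hp₂ := (hc (f _ _ (F (S.node (D.par n₂))).2 (D.par n₂)) (idx n₂)).2
    rw [h] at hp
    have hv := hp.1.symm.trans hp₂.1
    have hi := hp.2.symm.trans hp₂.2
    have hm : S.node (D.par n) = S.node (D.par n₂) := by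
      refine ih _ (hl ▸ D.lev_par n hn) rfl ?_
      have := congrArg S'.node hv
      rwa [(hf _ _ (F (S.node (D.par n))).2 _ rfl).1,
        (hf _ _ (F (S.node (D.par n₂))).2 _ rfl).1] at this
    have hinj : ∀ (m m₂ : N) (x x₂ : V), m = m₂ → S.node x = m → S.node x₂ = m₂ →
        f _ _ (F m).2 x = f _ _ (F m₂).2 x₂ → x = x₂ := by
      rintro m _ x x₂ rfl hx hx₂ h
      rw [← (hf _ _ (F m).2 x hx).2, h, (hf _ _ (F m).2 x₂ hx₂).2]
    exact (hidx (D.par n₂) (idx n₂)).unique ⟨hn, hinj _ _ _ _ hm rfl rfl hv, hi⟩ ⟨hn₂, rfl, rfl⟩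
  · intro n'
    induction hl : S'.lev n' using Nat.strong_induction_on generalizing n' with
    | _ l ih =>
    by_cases hn' : n' = S'.root
    · exact ⟨S.root, hn' ▸ hF0⟩
    obtain ⟨m, hm⟩ := ih _ (hl ▸ D'.lev_par n' hn') (S'.node (D'.par n')) rfl
    dsimp only at hm
    obtain ⟨hx1, hx2⟩ := hg _ _ (F m).2 (D'.par n') hm.symm
    obtain ⟨n, ⟨hn, hnp, hni⟩, -⟩ := hidx (g _ _ (F m).2 (D'.par n')) (idx' n')
    refine ⟨n, ?_⟩
    have hmn : S.node (D.par n) = m := by rw [hnp, hx1]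
    have key : ∀ k, k = m → f _ _ (F k).2 (D.par n) = D'.par n' := by
      rintro _ rfl
      rw [hnp, hx2]
    dsimp only
    rw [hF1 n hn, key _ hmn, hni]
    exact (hcu _ _ n' ⟨hn', rfl, rfl⟩).symm
  · rw [hF1 n hn, (hc _ _).2.1]

/-- The member isomorphisms along the matching of the trees glue to mutually inverse bijections on
vertices. They respect attaching vertices in parents exactly and marked vertices up to `R`, so an
attaching edge becomes a walk of length at most `R + 1`. -/
theorem coarselyEquivalent_of_exactMultiplicity (D : S.Hanging) (D' : S'.Hanging) {M R : ℕ}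
    (hroot : S.ty S.root = S'.ty S'.root) (hD : D.ExactMultiplicity M)
    (hD' : D'.ExactMultiplicity M) (hsim : S.SimilarMembers S' R) :
    CoarselyEquivalent D.graph D'.graph := by
  choose f g hf hg hfE hgE hatt using hsim
  obtain ⟨F, ⟨hinj, hsurj⟩, hF0, hF⟩ := D.exists_nodeEquiv D' hroot hD hD' f g hf hg
  choose G hG using hsurj
  dsimp only at hG
  have hGF : ∀ n, G (F n) = n := fun n => hinj (hG (F n))
  let Φ : V → V' := fun v => f _ _ (F (S.node v)).2 v
  let Ψ : V' → V := fun v => g _ _ (F (G (S'.node v))).2 v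
  have hΦ : ∀ n v, S.node v = n → Φ v = f _ _ (F n).2 v := by
    rintro _ v rfl
    rfl
  have hΨ : ∀ n v, S'.node v = F n → Ψ v = g _ _ (F n).2 v := by
    intro n v h
    have : ∀ k, k = n → g _ _ (F k).2 v = g _ _ (F n).2 v := by
      rintro _ rfl
      rfl
    exact this _ (by rw [h, hGF])
  have hΦnode : ∀ v, S'.node (Φ v) = F (S.node v) := fun v => (hf _ _ _ v rfl).1
  have hΨΦ : ∀ v, Ψ (Φ v) = v := fun v => by
    rw [hΨ _ _ (hΦnode v)]
    exact (hf _ _ _ v rfl).2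
  have hΦΨ : ∀ v, Φ (Ψ v) = v := fun v => by
    have h := hg _ _ (F (G (S'.node v))).2 v (hG _).symm
    rw [hΦ _ _ h.1]
    exact h.2
  refine ⟨Φ, Ψ, R + 1, ?_, ?_, fun x => by rw [hΨΦ]; exact Near.refl .., fun y => by
    rw [hΦΨ]; exact Near.refl ..⟩
  · refine D.near_map_of_adj (fun x y h => ?_) fun n hn => ?_
    · rw [hΦ _ y (S.node_eq_of_adj x y h).symm, hΦ _ x rfl]
      exact (Near.of_adj (D'.le_graph (hfE _ _ _ x y rfl h))).mono (by omega)
    · rw [hΦ n _ (S.node_att n)]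
      have := D'.near_par (hF n hn).1
      rw [(hF n hn).2] at this
      exact ((hatt _ _ (F n).2).of_le D'.le_graph).trans this
  · refine D'.near_map_of_adj (fun x y h => ?_) fun n' hn' => ?_
    · have hx : S'.node x = F (G (S'.node x)) := (hG _).symm
      rw [hΨ _ x hx, hΨ _ y ((S'.node_eq_of_adj x y h).symm.trans hx)]
      exact (Near.of_adj (D.le_graph (hgE _ _ _ x y hx h))).mono (by omega)
    · obtain ⟨n, rfl⟩ : ∃ n, (F n : N') = n' := ⟨_, hG n'⟩
      have hn : n ≠ S.root := by
        rintro rfl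
        exact hn' hF0
      have hpar : Ψ (D'.par (F n)) = D.par n := by
        rw [(hF n hn).2]
        exact hΨΦ _
      rw [hpar, hΨ n _ (S'.node_att _)]
      have hnear := (hatt _ _ (F n).2).symm.map_of (H := S.E) (C := 1)
        (P := fun v => S'.node v = F n) (f := g _ _ (F n).2)
        (fun a b ha hab => (S'.node_eq_of_adj a b hab).symm.trans ha)
        (fun a b ha hab => Near.of_adj (hgE _ _ _ a b ha hab)) (S'.node_att _)
      rw [(hf _ _ _ _ (S.node_att n)).2, one_mul] at hnear
      exact (hnear.of_le D.le_graph).trans (D.near_par hn)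

end Hanging

end SpaceFamily

/-! ### Consequences of local finiteness and quasi-transitivity. -/

namespace Near

variable {V : Type*} {G : SimpleGraph V}

lemma map_iso (γ : G ≃g G) {n : ℕ} {x y : V} (h : Near G n x y) : Near G n (γ x) (γ y) :=
  h.map_adj fun _ _ hab => γ.map_rel_iff.2 hab

lemma exists_of_finite (hG : G.Connected) {F F' : Set V} (hF : F.Finite) (hF' : F'.Finite) :
    ∃ D, ∀ x ∈ F, ∀ y ∈ F', Near G D x y := by
  choose d hd using fun x y => exists_of_reachable (hG.preconnected x y)
  obtain ⟨D, hD⟩ := ((hF.prod hF').image fun p => d p.1 p.2).bddAbove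
  exact ⟨D, fun x hx y hy => (hd x y).mono (hD ⟨(x, y), ⟨hx, hy⟩, rfl⟩)⟩

lemma finite_ball (hG : IsLocallyFinite G) (R : ℕ) (v : V) : {x | Near G R x v}.Finite := by
  induction R with
  | zero =>
    refine (Set.finite_singleton v).subset fun x hx => ?_
    have : G.edist x v ≤ 0 := by simpa [Near] using hx
    exact edist_eq_zero_iff.1 (nonpos_iff_eq_zero.1 this)
  | succ R ih =>
    refine (ih.union (ih.biUnion fun y _ => hG y)).subset fun x hx => ?_
    obtain ⟨p, hp⟩ := iff_walk.1 hx
    cases p with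
    | nil => exact Or.inl (refl ..)
    | cons h p =>
      rw [Walk.length_cons, Nat.add_le_add_iff_right] at hp
      exact Or.inr (Set.mem_biUnion (iff_walk.2 ⟨p, hp⟩ : Near G R _ v) h.symm)

end Near

section QuasiTransitive

variable {V K : Type*} {G : SimpleGraph V}

lemma IsQuasiTransitive.exists_near (hG : IsQuasiTransitive G) (hconn : G.Connected) :
    ∃ R, ∀ x y : V, ∃ γ : G ≃g G, Near G R (γ x) y := by
  obtain ⟨F, hF, hcov⟩ := hG
  obtain ⟨R, hR⟩ := Near.exists_of_finite hconn hF hF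
  refine ⟨R, fun x y => ?_⟩
  obtain ⟨γ, -, a, ha, rfl⟩ := hcov x
  obtain ⟨δ, -, b, hb, rfl⟩ := hcov y
  refine ⟨γ.symm.trans δ, ?_⟩
  simpa using (hR a ha b hb).map_iso δ

lemma IsQuasiTransitive.encard_ball_le (hG : IsQuasiTransitive G) (hfin : IsLocallyFinite G)
    (R : ℕ) : ∃ m : ℕ, ∀ v, {x | Near G R x v}.encard ≤ m := by
  obtain ⟨F, hF, hcov⟩ := hG
  obtain ⟨m, hm⟩ := (hF.image fun v => {x | Near G R x v}.ncard).bddAbove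
  refine ⟨m, fun v => ?_⟩
  obtain ⟨γ, -, a, ha, rfl⟩ := hcov v
  have hsub : {x | Near G R x (γ a)} ⊆ γ '' {x | Near G R x a} := by
    intro x hx
    refine ⟨γ.symm x, ?_, by simp⟩
    have := Near.map_iso γ.symm hx
    simpa using this
  refine (Set.encard_le_encard hsub).trans ((Set.encard_image_le _ _).trans ?_)
  rw [← (Near.finite_ball hfin R a).cast_ncard_eq]
  exact_mod_cast hm ⟨a, ha, rfl⟩

variable {Γ : Subgroup (G ≃g G)} {S : K → Set V}

lemma ActsQuasiTransitivelyOnSets.exists_near_of_mem (hconn : G.Connected)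
    (hΓ : ActsQuasiTransitivelyOnSets Γ (Set.range S)) (hS : ∀ k, (S k).Finite) :
    ∃ D, ∀ k, ∀ x ∈ S k, ∀ y ∈ S k, Near G D x y := by
  obtain ⟨-, F, hFS, hF, hcov⟩ := hΓ
  have hd : ∀ s : Set V, ∃ D, s ∈ F → ∀ x ∈ s, ∀ y ∈ s, Near G D x y := by
    intro s
    by_cases hs : s ∈ F
    · obtain ⟨k, rfl⟩ := hFS hs
      obtain ⟨D, hD⟩ := Near.exists_of_finite hconn (hS k) (hS k)
      exact ⟨D, fun _ => hD⟩
    · exact ⟨0, fun h => absurd h hs⟩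
  choose d hd using hd
  obtain ⟨D, hD⟩ := (hF.image d).bddAbove
  refine ⟨D, fun k x hx y hy => ?_⟩
  obtain ⟨γ, -, t, ht, h⟩ := hcov (S k) ⟨k, rfl⟩
  rw [← h] at hx hy
  obtain ⟨a, ha, rfl⟩ := hx
  obtain ⟨b, hb, rfl⟩ := hy
  exact ((hd t ht a ha b hb).mono (hD ⟨t, ht, rfl⟩)).map_iso γ

/-- Translates of one adhesion set come boundedly close to every vertex. As balls and adhesion sets
are finite and `V` is infinite, there are infinitely many adhesion sets. Fix `m` of them: they lie
within bounded distance of the orbit representatives, and the group carries them to any vertex. -/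
lemma ActsQuasiTransitively.exists_near_many (hconn : G.Connected) (hinf : Infinite V)
    (hfin : IsLocallyFinite G) (hΓ : ActsQuasiTransitively Γ)
    (hΓS : ActsQuasiTransitivelyOnSets Γ (Set.range S)) (hS : ∀ k, (S k).Finite)
    (hne : ∀ k, (S k).Nonempty) (hK : Nonempty K) (m : ℕ) :
    ∃ R, ∀ x, ∃ t : Finset K, t.card = m ∧ ∀ k ∈ t, ∀ p ∈ S k, Near G R x p := by
  classical
  obtain ⟨F, hF, hcov⟩ := hΓ
  have hinv := hΓS.1
  obtain ⟨k₀⟩ := hK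
  obtain ⟨R₀, hR₀⟩ := Near.exists_of_finite hconn hF (hS k₀)
  have hdense : ∀ x, ∃ s ∈ Set.range S, ∃ y ∈ s, Near G R₀ x y := by
    intro x
    obtain ⟨γ, hγ, a, ha, rfl⟩ := hcov x
    obtain ⟨p, hp⟩ := hne k₀
    exact ⟨_, hinv γ hγ _ ⟨k₀, rfl⟩, γ p, ⟨p, hp, rfl⟩, (hR₀ a ha p hp).map_iso γ⟩
  have hrange : (Set.range S).Infinite := by
    intro hr
    refine Set.infinite_univ (α := V) ?_
    have h1 : (⋃ s ∈ Set.range S, s).Finite := hr.biUnion (by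
      rintro _ ⟨k, rfl⟩
      exact hS k)
    refine (h1.biUnion fun y _ => Near.finite_ball hfin R₀ y).subset fun x _ => ?_
    obtain ⟨s, hs, y, hy, hxy⟩ := hdense x
    exact Set.mem_biUnion (Set.mem_biUnion hs hy) hxy
  obtain ⟨t, ht, htm⟩ := hrange.exists_subset_card_eq m
  have htfin : (⋃ s ∈ (t : Set (Set V)), s).Finite := t.finite_toSet.biUnion (by
    intro s hs
    obtain ⟨k, rfl⟩ := ht hs
    exact hS k)
  obtain ⟨R, hR⟩ := Near.exists_of_finite hconn hF htfin
  refine ⟨R, fun x => ?_⟩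
  obtain ⟨γ, hγ, a, ha, rfl⟩ := hcov x
  -- The translates are distinct sets, so labels chosen for them are distinct.
  have hl : ∀ s : t, ∃ k, S k = (fun y => γ y) '' (s : Set V) := fun s => hinv γ hγ s (ht s.2)
  choose l hl using hl
  have hlinj : Function.Injective l := by
    intro s s' h
    have := (hl s).symm.trans ((congrArg S h).trans (hl s'))
    exact Subtype.ext (Set.image_injective.2 γ.injective this)
  refine ⟨Finset.univ.image l, ?_, ?_⟩
  · rw [Finset.card_image_of_injective _ hlinj, Finset.card_univ, Fintype.card_coe, htm]
  · intro k hk p hp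
    obtain ⟨s, -, rfl⟩ := Finset.mem_image.1 hk
    rw [hl s] at hp
    obtain ⟨y, hy, rfl⟩ := hp
    exact (hR a ha y (Set.mem_biUnion s.2 hy)).map_iso γ

end QuasiTransitive

/-! ### Rooted trees and locally injective homomorphisms. -/

lemma SimpleGraph.IsTree.eq_of_dist_succ {N : Type*} {T : SimpleGraph N} (hT : T.IsTree)
    {o n m m' : N} (h : T.Adj n m) (h' : T.Adj n m') (hd : T.dist o n = T.dist o m + 1)
    (hd' : T.dist o n = T.dist o m' + 1) : m = m' := by
  obtain ⟨p, hp⟩ := hT.connected.exists_walk_length_eq_dist o m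
  obtain ⟨p', hp'⟩ := hT.connected.exists_walk_length_eq_dist o m'
  -- Both geodesics extend to paths from `o` to `n`; by uniqueness of paths their penultimate
  -- vertices agree.
  have h1 := (p.concat h.symm).isPath_of_length_eq_dist (by rw [Walk.length_concat, hp, hd])
  have h2 := (p'.concat h'.symm).isPath_of_length_eq_dist (by rw [Walk.length_concat, hp', hd'])
  have := congrArg (fun q : T.Path o n => q.1.penultimate)
    ((hT.isAcyclic.subsingleton_path _ _).elim ⟨_, h1⟩ ⟨_, h2⟩)
  simpa using this

lemma SimpleGraph.IsTree.exists_parent {N : Type*} {T : SimpleGraph N} (hT : T.IsTree) (o : N) :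
    ∃ π : N → N, (∀ n, n ≠ o → T.Adj n (π n) ∧ T.dist o n = T.dist o (π n) + 1) ∧
      ∀ n m, T.Adj n m → (m ≠ o ∧ π m = n) ∨ (n ≠ o ∧ π n = m) := by
  classical
  have h : ∀ n, ∃ m, n ≠ o → T.Adj n m ∧ T.dist o n = T.dist o m + 1 := by
    intro n
    by_cases hn : n = o
    · exact ⟨o, fun h => absurd hn h⟩
    obtain ⟨p, hp⟩ := hT.connected.exists_walk_length_eq_dist n o
    cases p with
    | nil => exact absurd rfl hn
    | @cons _ m _ h p =>
      refine ⟨m, fun _ => ⟨h, ?_⟩⟩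
      rw [Walk.length_cons] at hp
      have h1 := T.dist_le p
      rw [T.dist_comm] at h1 hp
      rcases hT.dist_eq_dist_add_one_of_adj o h with h2 | h2 <;> omega
  choose π hπ using h
  refine ⟨π, hπ, ?_⟩
  intro n m hnm
  rcases hT.dist_eq_dist_add_one_of_adj o hnm with h2 | h2
  · right
    have hn : n ≠ o := by
      rintro rfl
      simp at h2
    exact ⟨hn, hT.eq_of_dist_succ (hπ n hn).1 hnm (hπ n hn).2 h2⟩
  · left
    have hm : m ≠ o := by
      rintro rfl
      simp at h2
    exact ⟨hm, hT.eq_of_dist_succ (hπ m hm).1 hnm.symm (hπ m hm).2 h2⟩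

/-- In a forest a walk is a path once it never backtracks at once, and local injectivity excludes a
backtrack in the image of a path. -/
lemma SimpleGraph.IsAcyclic.isPath_map_of_locallyInjective {V N : Type*} {L : SimpleGraph V}
    {T : SimpleGraph N} (hT : T.IsAcyclic) (f : L →g T)
    (hf : ∀ x y z, L.Adj x y → L.Adj x z → f y = f z → y = z) {x y : V} {p : L.Walk x y}
    (hp : p.IsPath) : (p.map f).IsPath := by
  rw [hT.isPath_iff_isChain]
  induction p with
  | nil => simp
  | @cons a b _ h p ih =>
    have hp' := (Walk.cons_isPath_iff h p).1 hp
    specialize ih hp'.1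
    cases p with
    | nil => simp
    | @cons _ c _ h' p =>
      simp only [Walk.map_cons, Walk.edges_cons] at ih ⊢
      refine List.isChain_cons_cons.2 ⟨?_, ih⟩
      intro he
      have hac : f a = f c := by
        rcases Sym2.eq_iff.1 he with ⟨h1, -⟩ | ⟨h1, -⟩
        · exact absurd h1 (f.map_adj h).ne
        · exact h1
      apply hp'.2
      rw [hf b a c h.symm h' hac]
      simp

/-! ### The new edges and the fibres of `ψ`. -/

namespace TreeAmalgamation

variable {V₁ : Type u} {V₂ : Type v} {G₁ : SimpleGraph V₁} {G₂ : SimpleGraph V₂}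
  (A : TreeAmalgamation.{u, v, w} G₁ G₂)

/-- The disjoint union of the copies of `G₁` and `G₂`. -/
def copyGraph : SimpleGraph A.CopyVertex where
  Adj := A.CopyAdj
  symm := ⟨by
    rintro _ _ (⟨s, h⟩ | ⟨t, h⟩)
    · exact CopyAdj.left s h.symm
    · exact CopyAdj.right t h.symm⟩
  loopless := ⟨by
    rintro x h
    cases h with
    | left s h => exact h.ne rfl
    | right t h => exact h.ne rfl⟩

/-- The graph on the vertices of the copies whose edges are the new edges. -/
def linkGraph : SimpleGraph A.CopyVertex where
  Adj x y := A.Link x y ∨ A.Link y x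
  symm := ⟨fun _ _ h => h.symm⟩
  loopless := ⟨by
    rintro x (h | h) <;> cases h⟩

lemma node_eq_of_copyAdj {x y : A.CopyVertex} (h : A.CopyAdj x y) : A.node x = A.node y := by
  cases h <;> rfl

/-- A new edge of the disjoint union lies over an edge of the tree. -/
def linkHom : A.linkGraph →g A.T where
  toFun := A.node
  map_rel' := by
    rintro x y (⟨s, t, h, x⟩ | ⟨s, t, h, x⟩)
    · exact h
    · exact h.symm

/-- Across one tree edge, a copy vertex has at most one partner, as the gluing maps are bijections.
-/
lemma linkHom_locallyInjective (x y z : A.CopyVertex) (hy : A.linkGraph.Adj x y)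
    (hz : A.linkGraph.Adj x z) (h : A.linkHom y = A.linkHom z) : y = z := by
  change A.node y = A.node z at h
  rcases hy with hy | hy
  · obtain ⟨s, t, hst, x⟩ := hy
    rcases hz with hz | hz
    · generalize hx : (Sum.inl (s, (x : V₁)) : A.CopyVertex) = a at hz
      obtain ⟨s', t', hst', x'⟩ := hz
      obtain rfl : t = t' := Sum.inr_injective h
      simp only [Sum.inl.injEq, Prod.mk.injEq] at hx
      obtain ⟨rfl, hx⟩ := hx
      rw [Subtype.ext hx]
    · cases hz
  · obtain ⟨s, t, hst, x⟩ := hy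
    rcases hz with hz | hz
    · cases hz
    · generalize hx : (Sum.inr (t, (A.φ (A.label s t).1 (A.label s t).2 x : V₂)) :
        A.CopyVertex) = a at hz
      obtain ⟨s', t', hst', x'⟩ := hz
      obtain rfl : s = s' := Sum.inl_injective h
      simp only [Sum.inr.injEq, Prod.mk.injEq] at hx
      obtain ⟨rfl, hx⟩ := hx
      rw [(A.φ _ _).injective (Subtype.ext hx)]

lemma ψ_eq_iff_reachable {x y : A.CopyVertex} : A.ψ x = A.ψ y ↔ A.linkGraph.Reachable x y := by
  constructor
  · intro h
    have := Quot.eqvGen_exact h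
    clear h
    induction this with
    | rel x y h => exact Adj.reachable (G := A.linkGraph) (Or.inl h)
    | refl x => exact Reachable.refl x
    | symm x y h ih => exact ih.symm
    | trans x y z h h' ih ih' =>
      exact ih.trans ih'
  · rintro ⟨p⟩
    induction p with
    | nil => rfl
    | cons h p ih =>
      refine Eq.trans ?_ ih
      rcases h with h | h
      · exact Quot.sound h
      · exact (Quot.sound h).symm

variable {A}

lemma exists_encard_le_of_finiteIdentification {M : ℕ} {a : A.Vertex}
    (h : A.identificationSize a ≤ M) :
    ∃ U : Set (A.N₁ ⊕ A.N₂), U.encard ≤ M ∧ ∀ x, A.ψ x = a → A.node x ∈ U := by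
  have h' : A.identificationSize a < M + 1 :=
    lt_of_le_of_lt h (by exact_mod_cast Nat.lt_succ_self M)
  obtain ⟨n, ⟨U, -, hU, rfl⟩, hn⟩ := sInf_lt_iff.1 h'
  exact ⟨U, Order.le_of_lt_add_one hn, hU⟩

/-- A path of new edges stays in one fibre of `ψ` and projects to a path of the tree. Its nodes are
distinct and lie in a set of at most `M` nodes. -/
lemma near_linkGraph_of_ψ_eq {M : ℕ} {x y : A.CopyVertex}
    (hM : A.identificationSize (A.ψ x) ≤ M) (h : A.ψ x = A.ψ y) :
    Near A.linkGraph M x y := by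
  classical
  obtain ⟨U, hU, hxU⟩ := exists_encard_le_of_finiteIdentification hM
  obtain ⟨p, hp⟩ := (A.ψ_eq_iff_reachable.1 h).exists_isPath
  have hpath := A.isTree.isAcyclic.isPath_map_of_locallyInjective A.linkHom
    A.linkHom_locallyInjective hp
  refine Near.iff_walk.2 ⟨p, ?_⟩
  have hsub : (((p.map A.linkHom).support.toFinset : Finset _) : Set (A.N₁ ⊕ A.N₂)) ⊆ U := by
    intro n hn
    rw [Finset.mem_coe, List.mem_toFinset, Walk.support_map, List.mem_map] at hn
    obtain ⟨z, hz, rfl⟩ := hn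
    refine hxU z ?_
    exact A.ψ_eq_iff_reachable.2 ⟨(p.takeUntil z hz).reverse⟩
  have hcard := (Set.encard_le_encard hsub).trans hU
  rw [Set.encard_coe_eq_coe_finsetCard, List.toFinset_card_of_nodup hpath.support_nodup,
    Walk.length_support, Walk.length_map] at hcard
  have : p.length + 1 ≤ M := by exact_mod_cast hcard
  omega

/-- A tree without edges is a single node; then nothing is glued, and the only copy is the whole
amalgamation. -/
lemma exists_adj_of_not_isTrivial (hA : ¬ A.IsTrivial) :
    ∃ s t, A.T.Adj (Sum.inl s) (Sum.inr t) := by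
  by_contra! hno
  have hno' : ∀ n m, ¬ A.T.Adj n m := by
    rintro (s | t) (s' | t') h
    · simpa using A.bipartite h
    · exact hno _ _ h
    · exact hno _ _ h.symm
    · simpa using A.bipartite h
  have hnode : ∀ n m : A.N₁ ⊕ A.N₂, n = m := by
    intro n m
    obtain ⟨p⟩ := A.isTree.connected.preconnected n m
    cases p with
    | nil => rfl
    | cons h p => exact absurd h (hno' _ _)
  have hinj : Function.Injective A.ψ := by
    intro x y h
    obtain ⟨p⟩ := A.ψ_eq_iff_reachable.1 h
    cases p with
    | nil => rfl
    | cons h p => exact absurd (A.linkHom.map_adj h) (hno' _ _)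
  apply hA
  obtain ⟨s | t⟩ := A.isTree.connected.nonempty
  · refine Or.inl ⟨s, ?_, ?_⟩
    · intro x y h
      simpa using hinj h
    · rintro ⟨⟨s', x⟩ | ⟨t, x⟩⟩
      · obtain rfl := Sum.inl_injective (hnode (Sum.inl s) (Sum.inl s'))
        exact ⟨x, rfl⟩
      · cases hnode (Sum.inl s) (Sum.inr t)
  · refine Or.inr ⟨t, ?_, ?_⟩
    · intro x y h
      simpa using hinj h
    · rintro ⟨⟨s, x⟩ | ⟨t', x⟩⟩
      · cases hnode (Sum.inl s) (Sum.inr t)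
      · obtain rfl := Sum.inr_injective (hnode (Sum.inr t) (Sum.inr t'))
        exact ⟨x, rfl⟩

/-! ### The copies as a family of graphs. -/

variable (A)

/-- The copies of `G₁` and `G₂` as a family of graphs; the types are the two sides of the
bipartition and the levels are the distances from `o` in the tree. -/
noncomputable def copyFamily (o : A.N₁ ⊕ A.N₂) (att : A.N₁ ⊕ A.N₂ → A.CopyVertex)
    (hatt : ∀ n, A.node (att n) = n) : SpaceFamily (A.N₁ ⊕ A.N₂) A.CopyVertex where
  E := A.copyGraph
  node := A.node
  node_eq_of_adj _ _ h := A.node_eq_of_copyAdj h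
  root := o
  att := att
  node_att := hatt
  lev := A.T.dist o
  ty := Sum.isLeft

variable {A}

lemma near_inl {R : ℕ} {x y : V₁} (s : A.N₁) (h : Near G₁ R x y) :
    Near A.copyGraph R (Sum.inl (s, x)) (Sum.inl (s, y)) :=
  h.map_adj (f := fun x => (Sum.inl (s, x) : A.CopyVertex)) fun _ _ h => CopyAdj.left s h

lemma near_inr {R : ℕ} {x y : V₂} (t : A.N₂) (h : Near G₂ R x y) :
    Near A.copyGraph R (Sum.inr (t, x)) (Sum.inr (t, y)) :=
  h.map_adj (f := fun x => (Sum.inr (t, x) : A.CopyVertex)) fun _ _ h => CopyAdj.right t h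

/-- The second component of a vertex in a copy of `G₁`, with a default value. -/
def fstVertex (x₁ : V₁) : A.CopyVertex → V₁ := Sum.elim Prod.snd fun _ => x₁

/-- The second component of a vertex in a copy of `G₂`, with a default value. -/
def sndVertex (x₂ : V₂) : A.CopyVertex → V₂ := Sum.elim (fun _ => x₂) Prod.snd

lemma near_of_near_copyGraph_inl {R : ℕ} {s : A.N₁} {x : V₁} {z : A.CopyVertex}
    (h : Near A.copyGraph R z (Sum.inl (s, x))) : ∃ y, z = Sum.inl (s, y) ∧ Near G₁ R y x := by
  obtain ⟨p, hp⟩ := Near.iff_walk.1 h.symm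
  have key : ∀ {a b : A.CopyVertex} (p : A.copyGraph.Walk a b) (s : A.N₁) (x : V₁),
      a = Sum.inl (s, x) → ∃ y, b = Sum.inl (s, y) ∧ Near G₁ p.length x y := by
    intro a b p
    induction p with
    | nil => exact fun s x h => ⟨x, h, Near.refl ..⟩
    | cons h p ih =>
      rintro s x rfl
      have hadj : A.CopyAdj _ _ := h
      cases hadj with
      | left _ h' =>
        obtain ⟨y, hy, hxy⟩ := ih s _ rfl
        refine ⟨y, hy, ((Near.of_adj h').trans hxy).mono ?_⟩
        rw [Walk.length_cons, add_comm]
  obtain ⟨y, hy, hxy⟩ := key p s x rfl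
  exact ⟨y, hy, (hxy.mono hp).symm⟩

lemma near_of_near_copyGraph_inr {R : ℕ} {t : A.N₂} {x : V₂} {z : A.CopyVertex}
    (h : Near A.copyGraph R z (Sum.inr (t, x))) : ∃ y, z = Sum.inr (t, y) ∧ Near G₂ R y x := by
  obtain ⟨p, hp⟩ := Near.iff_walk.1 h.symm
  have key : ∀ {a b : A.CopyVertex} (p : A.copyGraph.Walk a b) (t : A.N₂) (x : V₂),
      a = Sum.inr (t, x) → ∃ y, b = Sum.inr (t, y) ∧ Near G₂ p.length x y := by
    intro a b p
    induction p with
    | nil => exact fun t x h => ⟨x, h, Near.refl ..⟩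
    | cons h p ih =>
      rintro t x rfl
      have hadj : A.CopyAdj _ _ := h
      cases hadj with
      | right _ h' =>
        obtain ⟨y, hy, hxy⟩ := ih t _ rfl
        refine ⟨y, hy, ((Near.of_adj h').trans hxy).mono ?_⟩
        rw [Walk.length_cons, add_comm]
  obtain ⟨y, hy, hxy⟩ := key p t x rfl
  exact ⟨y, hy, (hxy.mono hp).symm⟩

lemma boundedBalls_copyFamily (hfin₁ : IsLocallyFinite G₁) (hfin₂ : IsLocallyFinite G₂)
    (hqt₁ : IsQuasiTransitive G₁) (hqt₂ : IsQuasiTransitive G₂) (o : A.N₁ ⊕ A.N₂)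
    (att : A.N₁ ⊕ A.N₂ → A.CopyVertex) (hatt : ∀ n, A.node (att n) = n) :
    (A.copyFamily o att hatt).BoundedBalls := by
  intro R
  obtain ⟨m₁, h₁⟩ := hqt₁.encard_ball_le hfin₁ R
  obtain ⟨m₂, h₂⟩ := hqt₂.encard_ball_le hfin₂ R
  refine ⟨max m₁ m₂, ?_⟩
  rintro (⟨s, x⟩ | ⟨t, x⟩)
  · have hsub : {z | Near A.copyGraph R z (Sum.inl (s, x))} ⊆
        (fun y => (Sum.inl (s, y) : A.CopyVertex)) '' {y | Near G₁ R y x} := by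
      intro z hz
      obtain ⟨y, rfl, hy⟩ := near_of_near_copyGraph_inl hz
      exact ⟨y, hy, rfl⟩
    refine (Set.encard_le_encard hsub).trans ((Set.encard_image_le _ _).trans ((h₁ x).trans ?_))
    exact_mod_cast le_max_left _ _
  · have hsub : {z | Near A.copyGraph R z (Sum.inr (t, x))} ⊆
        (fun y => (Sum.inr (t, y) : A.CopyVertex)) '' {y | Near G₂ R y x} := by
      intro z hz
      obtain ⟨y, rfl, hy⟩ := near_of_near_copyGraph_inr hz
      exact ⟨y, hy, rfl⟩
    refine (Set.encard_le_encard hsub).trans ((Set.encard_image_le _ _).trans ((h₂ x).trans ?_))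
    exact_mod_cast le_max_right _ _

/-- Automorphisms of a factor move any vertex to within a uniform distance of any other, hence
nearly align the marked vertices of two copies. -/
lemma similarMembers_copyFamily {B : TreeAmalgamation.{u, v, w'} G₁ G₂} (hconn₁ : G₁.Connected)
    (hconn₂ : G₂.Connected) (hqt₁ : IsQuasiTransitive G₁) (hqt₂ : IsQuasiTransitive G₂)
    (o : A.N₁ ⊕ A.N₂) (att : A.N₁ ⊕ A.N₂ → A.CopyVertex) (hatt : ∀ n, A.node (att n) = n)
    (o' : B.N₁ ⊕ B.N₂) (att' : B.N₁ ⊕ B.N₂ → B.CopyVertex)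
    (hatt' : ∀ n, B.node (att' n) = n) :
    ∃ R, (A.copyFamily o att hatt).SimilarMembers (B.copyFamily o' att' hatt') R := by
  obtain ⟨R₁, h₁⟩ := hqt₁.exists_near hconn₁
  obtain ⟨R₂, h₂⟩ := hqt₂.exists_near hconn₂
  obtain ⟨x₁⟩ := hconn₁.nonempty
  obtain ⟨x₂⟩ := hconn₂.nonempty
  refine ⟨max R₁ R₂, ?_⟩
  rintro (s | t) (s' | t') hty
  · obtain ⟨γ, hγ⟩ := h₁ (fstVertex x₁ (att (Sum.inl s))) (fstVertex x₁ (att' (Sum.inl s')))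
    refine ⟨fun z => Sum.inl (s', γ (fstVertex x₁ z)),
      fun z => Sum.inl (s, γ.symm (fstVertex x₁ z)), ?_, ?_, ?_, ?_, ?_⟩
    · rintro (⟨a, x⟩ | ⟨a, x⟩) h
      · obtain rfl := Sum.inl_injective h
        exact ⟨rfl, by simp [fstVertex]⟩
      · cases h
    · rintro (⟨a, x⟩ | ⟨a, x⟩) h
      · obtain rfl := Sum.inl_injective h
        exact ⟨rfl, by simp [fstVertex]⟩
      · cases h
    · rintro v w hv (⟨a, h⟩ | ⟨a, h⟩)
      · exact CopyAdj.left s' (γ.map_rel_iff.2 h)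
      · cases hv
    · rintro v w hv (⟨a, h⟩ | ⟨a, h⟩)
      · exact CopyAdj.left s (γ.symm.map_rel_iff.2 h)
      · cases hv
    · have hn := hatt' (Sum.inl s')
      change Near B.copyGraph _ _ (att' (Sum.inl s'))
      change Near G₁ R₁ (γ (fstVertex x₁ (att (Sum.inl s)))) _ at hγ
      generalize att' (Sum.inl s') = b at *
      obtain ⟨a, y⟩ | ⟨a, y⟩ := b
      · obtain rfl := Sum.inl_injective hn
        exact (near_inl _ hγ).mono (le_max_left _ _)
      · cases hn
  · cases hty
  · cases hty
  · obtain ⟨γ, hγ⟩ := h₂ (sndVertex x₂ (att (Sum.inr t))) (sndVertex x₂ (att' (Sum.inr t')))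
    refine ⟨fun z => Sum.inr (t', γ (sndVertex x₂ z)),
      fun z => Sum.inr (t, γ.symm (sndVertex x₂ z)), ?_, ?_, ?_, ?_, ?_⟩
    · rintro (⟨a, x⟩ | ⟨a, x⟩) h
      · cases h
      · obtain rfl := Sum.inr_injective h
        exact ⟨rfl, by simp [sndVertex]⟩
    · rintro (⟨a, x⟩ | ⟨a, x⟩) h
      · cases h
      · obtain rfl := Sum.inr_injective h
        exact ⟨rfl, by simp [sndVertex]⟩
    · rintro v w hv (⟨a, h⟩ | ⟨a, h⟩)
      · cases hv
      · exact CopyAdj.right t' (γ.map_rel_iff.2 h)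
    · rintro v w hv (⟨a, h⟩ | ⟨a, h⟩)
      · cases hv
      · exact CopyAdj.right t (γ.symm.map_rel_iff.2 h)
    · have hn := hatt' (Sum.inr t')
      change Near B.copyGraph _ _ (att' (Sum.inr t'))
      generalize att' (Sum.inr t') = b at *
      obtain ⟨a, y⟩ | ⟨a, y⟩ := b
      · cases hn
      · obtain rfl := Sum.inr_injective hn
        exact (near_inr _ hγ).mono (le_max_right _ _)

end TreeAmalgamation

namespace SpaceFamily.Hanging

lemma MultiplicityLE.mono {N V : Type*} {S : SpaceFamily N V} {D : S.Hanging} {M M' : ℕ}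
    (h : D.MultiplicityLE M) (hM : M ≤ M') : D.MultiplicityLE M' :=
  fun v => (h v).trans (by exact_mod_cast hM)

end SpaceFamily.Hanging

/-! ### The hanging given by the rooted tree of an amalgamation. -/

namespace TreeAmalgamation

variable {V₁ : Type u} {V₂ : Type v} {G₁ : SimpleGraph V₁} {G₂ : SimpleGraph V₂}
  (A : TreeAmalgamation.{u, v, w} G₁ G₂)

/-- A vertex from each adhesion set, and a vertex of each of the two graphs. -/
structure BasePoints where
  p : A.K₁ → V₁
  p_mem : ∀ k, p k ∈ A.S₁ k
  q : A.K₂ → V₂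
  q_mem : ∀ l, q l ∈ A.S₂ l
  x₁ : V₁
  x₂ : V₂

lemma nonempty_basePoints (h₁ : Nonempty V₁) (h₂ : Nonempty V₂) : Nonempty A.BasePoints := by
  choose p hp using A.S₁_nonempty
  choose q hq using A.S₂_nonempty
  exact ⟨⟨p, hp, q, hq, h₁.some, h₂.some⟩⟩

variable {A}

/-- The base point, in the copy at the first node, of the adhesion set that belongs to the edge
between the two nodes. -/
def BasePoints.gate (b : A.BasePoints) : A.N₁ ⊕ A.N₂ → A.N₁ ⊕ A.N₂ → A.CopyVertex
  | Sum.inl s, Sum.inr t => Sum.inl (s, b.p (A.label s t).1)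
  | Sum.inr t, Sum.inl s => Sum.inr (t, b.q (A.label s t).2)
  | Sum.inl s, Sum.inl _ => Sum.inl (s, b.x₁)
  | Sum.inr t, Sum.inr _ => Sum.inr (t, b.x₂)

lemma BasePoints.node_gate (b : A.BasePoints) (n m : A.N₁ ⊕ A.N₂) : A.node (b.gate n m) = n := by
  rcases n with s | t <;> rcases m with s' | t' <;> rfl

lemma isLeft_eq_not_of_adj {n m : A.N₁ ⊕ A.N₂} (h : A.T.Adj n m) : n.isLeft = !m.isLeft := by
  have := A.bipartite h
  rcases n with s | t <;> rcases m with s' | t' <;> simp_all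

/-- A gate is identified with a vertex of the copy on the other side of the edge. -/
lemma BasePoints.exists_ψ_eq_gate (b : A.BasePoints) {n m : A.N₁ ⊕ A.N₂} (h : A.T.Adj n m) :
    ∃ z, A.node z = m ∧ A.ψ z = A.ψ (b.gate n m) := by
  have hb := A.bipartite h
  rcases n with s | t <;> rcases m with s' | t'
  · simp at hb
  · exact ⟨_, rfl, (Quot.sound (Link.mk s t' h ⟨_, b.p_mem _⟩)).symm⟩
  · let y := (A.φ (A.label s' t).1 (A.label s' t).2).symm ⟨_, b.q_mem _⟩
    have := Quot.sound (Link.mk s' t h.symm y)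
    simp only [y, Equiv.apply_symm_apply] at this
    exact ⟨_, rfl, this⟩
  · simp at hb

/-- The canonical map `ψ` does not increase distances. -/
lemma near_graph_of_near_copyGraph {R : ℕ} {x y : A.CopyVertex} (h : Near A.copyGraph R x y) :
    Near A.graph R (A.ψ x) (A.ψ y) := by
  have := h.map (H := A.graph) (C := 1) (f := A.ψ) fun a b hab => ?_
  · simpa using this
  · by_cases hne : A.ψ a = A.ψ b
    · rw [hne]
      exact Near.refl ..
    · exact Near.of_adj ⟨hne, a, b, hab, rfl, rfl⟩

/-- The copies, hung along the tree rooted at `o`. -/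
noncomputable def treeHanging (b : A.BasePoints) (o : A.N₁ ⊕ A.N₂) (π : A.N₁ ⊕ A.N₂ → A.N₁ ⊕ A.N₂)
    (hπ : ∀ n, n ≠ o → A.T.Adj n (π n) ∧ A.T.dist o n = A.T.dist o (π n) + 1) :
    (A.copyFamily o (fun n => b.gate n (π n)) fun n => b.node_gate n (π n)).Hanging where
  par n := b.gate (π n) n
  lev_par n hn := by
    change A.T.dist o (A.node (b.gate (π n) n)) < A.T.dist o n
    rw [b.node_gate, (hπ n hn).2]
    exact Nat.lt_succ_self _
  ty_par n hn := by
    change n.isLeft = !(A.node (b.gate (π n) n)).isLeft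
    rw [b.node_gate, isLeft_eq_not_of_adj (hπ n hn).1]

section

variable {b : A.BasePoints} {o : A.N₁ ⊕ A.N₂} {π : A.N₁ ⊕ A.N₂ → A.N₁ ⊕ A.N₂}
  (hπ : ∀ n, n ≠ o → A.T.Adj n (π n) ∧ A.T.dist o n = A.T.dist o (π n) + 1)
  (hπ' : ∀ n m, A.T.Adj n m → (m ≠ o ∧ π m = n) ∨ (n ≠ o ∧ π n = m))

/-- If `n` hangs at `z`, some vertex of the copy at `n` is identified with `z`, so the node `n`
counts towards the identification size of `A.ψ z`. -/
lemma multiplicityLE_treeHanging {M : ℕ} (hM : ∀ a, A.identificationSize a ≤ M) :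
    (treeHanging b o π hπ).MultiplicityLE M := by
  intro z
  obtain ⟨U, hU, hzU⟩ := exists_encard_le_of_finiteIdentification (hM (A.ψ z))
  refine (Set.encard_le_encard ?_).trans hU
  rintro n ⟨hn, rfl⟩
  obtain ⟨y, rfl, hy⟩ := b.exists_ψ_eq_gate (hπ n hn).1.symm
  exact hzU y hy

include hπ' in
lemma near_treeHanging_gate {n m : A.N₁ ⊕ A.N₂} (h : A.T.Adj n m) :
    Near (treeHanging b o π hπ).graph 1 (b.gate n m) (b.gate m n) := by
  rcases hπ' n m h with ⟨hm, rfl⟩ | ⟨hn, rfl⟩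
  · exact ((treeHanging b o π hπ).near_par hm).symm
  · exact (treeHanging b o π hπ).near_par hn

include hπ' in
lemma exists_children {R : ℕ} {K : Type*} {n : A.N₁ ⊕ A.N₂} {z : A.CopyVertex} {t : Finset K}
    {m : ℕ} (ht : t.card = m + 1) (e : K → A.N₁ ⊕ A.N₂) (he : Set.InjOn e t)
    (h : ∀ k ∈ t, A.T.Adj n (e k) ∧ Near A.copyGraph R z (b.gate n (e k))) :
    ∃ t' : Finset (A.N₁ ⊕ A.N₂), t'.card = m ∧ ∀ k ∈ t',
      k ≠ o ∧ Near A.copyGraph R z ((treeHanging b o π hπ).par k) := by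
  classical
  -- One of the `m + 1` neighbours may be the parent of `n`; all others are children.
  have hcard : m ≤ ((t.image e).erase (π n)).card := by
    have := Finset.pred_card_le_card_erase (s := t.image e) (a := π n)
    rw [Finset.card_image_of_injOn he] at this
    omega
  obtain ⟨t', hsub, ht'⟩ := Finset.exists_subset_card_eq hcard
  refine ⟨t', ht', fun c hc => ?_⟩
  have hc' := hsub hc
  rw [Finset.mem_erase, Finset.mem_image] at hc'
  obtain ⟨hne, k, hk, rfl⟩ := hc'
  obtain ⟨hadj, hnear⟩ := h k hk
  rcases hπ' n _ hadj with ⟨hm, hp⟩ | ⟨-, hp⟩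
  · refine ⟨hm, ?_⟩
    change Near A.copyGraph R z (b.gate (π (e k)) (e k))
    rwa [hp]
  · exact absurd hp.symm hne

-- Near each vertex there are many adhesion sets with distinct labels, and every label occurs on an
-- edge at every node of its side.
include hπ' in
lemma abundant_treeHanging (hinf₁ : Infinite V₁) (hinf₂ : Infinite V₂)
    (hconn₁ : G₁.Connected) (hconn₂ : G₂.Connected)
    (hfin₁ : IsLocallyFinite G₁) (hfin₂ : IsLocallyFinite G₂)
    (hadh : A.FiniteAdhesion) (hact : A.HasQuasiTransitiveActions)
    (hK₁ : Nonempty A.K₁) (hK₂ : Nonempty A.K₂) : (treeHanging b o π hπ).Abundant := by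
  intro m
  obtain ⟨⟨Γ₁, hΓ₁, hΓS₁⟩, Γ₂, hΓ₂, hΓS₂⟩ := hact
  obtain ⟨R₁, h₁⟩ := hΓ₁.exists_near_many hconn₁ hinf₁ hfin₁ hΓS₁ hadh.1 A.S₁_nonempty hK₁ (m + 1)
  obtain ⟨R₂, h₂⟩ := hΓ₂.exists_near_many hconn₂ hinf₂ hfin₂ hΓS₂ hadh.2 A.S₂_nonempty hK₂ (m + 1)
  refine ⟨max R₁ R₂, ?_⟩
  rintro (⟨s, x⟩ | ⟨s, x⟩)
  · obtain ⟨t, ht, h⟩ := h₁ x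
    choose e he heu using A.label_fst s
    refine exists_children hπ hπ' ht (n := Sum.inl s) (fun k => Sum.inr (e k)) ?_ ?_
    · intro k _ k' _ hkk
      rw [← (he k).2, Sum.inr_injective hkk, (he k').2]
    · intro k hk
      refine ⟨(he k).1, ?_⟩
      change Near A.copyGraph _ _ (Sum.inl (s, b.p (A.label s (e k)).1))
      rw [(he k).2]
      exact (near_inl s (h k hk _ (b.p_mem k))).mono (le_max_left _ _)
  · obtain ⟨t, ht, h⟩ := h₂ x
    choose e he heu using A.label_snd s
    refine exists_children hπ hπ' ht (n := Sum.inr s) (fun k => Sum.inl (e k)) ?_ ?_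
    · intro k _ k' _ hkk
      rw [← (he k).2, Sum.inl_injective hkk, (he k').2]
    · intro k hk
      refine ⟨(he k).1.symm, ?_⟩
      change Near A.copyGraph _ _ (Sum.inr (s, b.q (A.label (e k) s).2))
      rw [(he k).2]
      exact (near_inr s (h k hk _ (b.q_mem k))).mono (le_max_right _ _)

-- The map `ψ` in one direction, any section of it in the other. A new edge can be replaced by a
-- detour through the gates of its tree edge, which costs at most the diameters `D₁` and `D₂`; so
-- fibres of `ψ` stay bounded in the hanging.
include hπ' in
lemma coarselyEquivalent_treeHanging {M D₁ D₂ : ℕ} (hM : ∀ a, A.identificationSize a ≤ M)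
    (hD₁ : ∀ k, ∀ x ∈ A.S₁ k, ∀ y ∈ A.S₁ k, Near G₁ D₁ x y)
    (hD₂ : ∀ k, ∀ x ∈ A.S₂ k, ∀ y ∈ A.S₂ k, Near G₂ D₂ x y) :
    CoarselyEquivalent (treeHanging b o π hπ).graph A.graph := by
  have hlink : ∀ x y, A.linkGraph.Adj x y →
      Near (treeHanging b o π hπ).graph (D₁ + 1 + D₂) x y := by
    have key : ∀ x y, A.Link x y → Near (treeHanging b o π hπ).graph (D₁ + 1 + D₂) x y := by
      rintro _ _ ⟨s, t, h, x⟩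
      have h1 := (near_inl s (hD₁ _ x x.2 _ (b.p_mem _))).of_le (treeHanging b o π hπ).le_graph
      have h2 := (near_inr t (hD₂ _ _ (b.q_mem _) _
        (A.φ (A.label s t).1 (A.label s t).2 x).2)).of_le (treeHanging b o π hπ).le_graph
      exact (h1.trans (near_treeHanging_gate hπ hπ' h)).trans h2
    rintro x y (h | h)
    · exact key x y h
    · exact (key y x h).symm
  have hfib : ∀ x y, A.ψ x = A.ψ y →
      Near (treeHanging b o π hπ).graph ((D₁ + 1 + D₂) * M) x y := fun x y h =>
    (near_linkGraph_of_ψ_eq (hM _) h).map (f := id) hlink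
  have hgate : ∀ n m, A.T.Adj n m → Near A.graph D₂ (A.ψ (b.gate n m)) (A.ψ (b.gate m n)) := by
    have key : ∀ s t, A.T.Adj (Sum.inl s) (Sum.inr t) → Near A.graph D₂
        (A.ψ (b.gate (Sum.inl s) (Sum.inr t))) (A.ψ (b.gate (Sum.inr t) (Sum.inl s))) := by
      intro s t h
      -- The gate at `s` is identified with a vertex of the adhesion set at `t` that also contains
      -- the gate at `t`.
      have h1 : A.ψ (b.gate (Sum.inl s) (Sum.inr t)) = _ :=
        Quot.sound (Link.mk s t h ⟨_, b.p_mem _⟩)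
      rw [h1]
      exact near_graph_of_near_copyGraph (near_inr t (hD₂ _ _ (Subtype.coe_prop _) _ (b.q_mem _)))
    intro n m h
    have hb := A.bipartite h
    rcases n with s | t <;> rcases m with s' | t'
    · simp at hb
    · exact key _ _ h
    · exact (key _ _ h.symm).symm
    · simp at hb
  choose g hg using fun a : A.Vertex => Quot.exists_rep a
  change ∀ a, A.ψ (g a) = a at hg
  -- An edge of the amalgamation lifts to one copy edge plus a correction within a fibre at each
  -- end; `D₂` is for attaching edges.
  refine ⟨A.ψ, g, 2 * ((D₁ + 1 + D₂) * M) + D₂ + 1, ?_, ?_, ?_, ?_⟩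
  · refine (treeHanging b o π hπ).near_map_of_adj (fun x y h => ?_) fun n hn => ?_
    · exact (near_graph_of_near_copyGraph (Near.of_adj h)).mono (by omega)
    · exact (hgate _ _ (hπ n hn).1).mono (by omega)
  · rintro _ _ ⟨-, x, y, h, rfl, rfl⟩
    have h1 := hfib _ _ (hg (A.ψ x))
    have h2 := hfib _ _ (hg (A.ψ y))
    have h3 := Near.of_adj ((treeHanging b o π hπ).le_graph (show A.copyGraph.Adj x y from h))
    exact ((h1.trans h3).trans h2.symm).mono (by omega)
  · exact fun x => (hfib _ _ (hg (A.ψ x))).mono (by omega)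
  · intro a
    rw [hg]
    exact Near.refl ..

end

/-- A tree amalgamation as in the theorem is coarsely equivalent to a hanging of copies of the two
graphs in which, at each vertex, the same number of copies of the other graph hangs. -/
lemma exists_hanging (hinf₁ : Infinite V₁) (hinf₂ : Infinite V₂)
    (hconn₁ : G₁.Connected) (hconn₂ : G₂.Connected)
    (hfin₁ : IsLocallyFinite G₁) (hfin₂ : IsLocallyFinite G₂)
    (hqt₁ : IsQuasiTransitive G₁) (hqt₂ : IsQuasiTransitive G₂)
    (hA : ¬ A.IsTrivial) (hadh : A.FiniteAdhesion) (hid : A.FiniteIdentification)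
    (hact : A.HasQuasiTransitiveActions) :
    ∃ M₀, ∀ M, M₀ ≤ M → ∃ (s : A.N₁) (att : A.N₁ ⊕ A.N₂ → A.CopyVertex)
      (hatt : ∀ n, A.node (att n) = n) (D : (A.copyFamily (Sum.inl s) att hatt).Hanging),
      D.ExactMultiplicity M ∧ CoarselyEquivalent A.graph D.graph := by
  obtain ⟨M₀, hM₀⟩ := hid
  obtain ⟨s, t, hst⟩ := exists_adj_of_not_isTrivial hA
  obtain ⟨b⟩ := A.nonempty_basePoints hconn₁.nonempty hconn₂.nonempty
  obtain ⟨π, hπ, hπ'⟩ := A.isTree.exists_parent (Sum.inl s)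
  obtain ⟨D₁, hD₁⟩ := hact.1.choose_spec.2.exists_near_of_mem hconn₁ hadh.1
  obtain ⟨D₂, hD₂⟩ := hact.2.choose_spec.2.exists_near_of_mem hconn₂ hadh.2
  -- The root is taken on the side of `G₁`, so that the roots for any two amalgamations have the
  -- same type.
  refine ⟨M₀, fun M hM => ⟨s, _, fun n => b.node_gate n (π n), ?_⟩⟩
  obtain ⟨D', hD', hequiv⟩ := (treeHanging b (Sum.inl s) π hπ).exists_exactMultiplicity
    ((multiplicityLE_treeHanging hπ hM₀).mono hM)
    (abundant_treeHanging hπ hπ' hinf₁ hinf₂ hconn₁ hconn₂ hfin₁ hfin₂ hadh hact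
      ⟨(A.label s t).1⟩ ⟨(A.label s t).2⟩)
    (boundedBalls_copyFamily hfin₁ hfin₂ hqt₁ hqt₂ _ _ _)
  exact ⟨D', hD', (coarselyEquivalent_treeHanging hπ hπ' hM₀ hD₁ hD₂).symm.trans hequiv⟩

end TreeAmalgamation

theorem mainTheorem3 {V₁ : Type u} {V₂ : Type v}
    (G₁ : SimpleGraph V₁) (G₂ : SimpleGraph V₂)
    (hinf₁ : Infinite V₁) (hinf₂ : Infinite V₂)
    (hconn₁ : G₁.Connected) (hconn₂ : G₂.Connected)
    (hfin₁ : IsLocallyFinite G₁) (hfin₂ : IsLocallyFinite G₂)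
    (hqt₁ : IsQuasiTransitive G₁) (hqt₂ : IsQuasiTransitive G₂)
    (A : TreeAmalgamation.{u, v, w} G₁ G₂) (B : TreeAmalgamation.{u, v, w'} G₁ G₂)
    (hA : ¬ A.IsTrivial) (hB : ¬ B.IsTrivial)
    (hAadh : A.FiniteAdhesion) (hBadh : B.FiniteAdhesion)
    (hAid : A.FiniteIdentification) (hBid : B.FiniteIdentification)
    (hAact : A.HasQuasiTransitiveActions) (hBact : B.HasQuasiTransitiveActions) :
    QuasiIsometric A.graph B.graph := by
  obtain ⟨M, hM⟩ := TreeAmalgamation.exists_hanging hinf₁ hinf₂ hconn₁ hconn₂ hfin₁ hfin₂ hqt₁ hqt₂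
    hA hAadh hAid hAact
  obtain ⟨M', hM'⟩ := TreeAmalgamation.exists_hanging hinf₁ hinf₂ hconn₁ hconn₂ hfin₁ hfin₂ hqt₁
    hqt₂ hB hBadh hBid hBact
  -- Multiplicities can be raised freely above the bounds, so one value serves both amalgamations.
  obtain ⟨s, att, hatt, D, hD, hAD⟩ := hM (max M M') (le_max_left _ _)
  obtain ⟨s', att', hatt', D', hD', hBD⟩ := hM' (max M M') (le_max_right _ _)
  obtain ⟨R, hR⟩ := TreeAmalgamation.similarMembers_copyFamily hconn₁ hconn₂ hqt₁ hqt₂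
    (Sum.inl s) att hatt (Sum.inl s') att' hatt'
  exact ((hAD.trans (D.coarselyEquivalent_of_exactMultiplicity D' rfl hD hD' hR)).trans
    hBD.symm).quasiIsometric
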